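/- Fix $\kappa>0$, $\lambda\in\mathbb R$ and let $K(x)=\lambda\,\frac{e^{-\kappa|x|}}{|x|}$ on $\mathbb R^3$ be the screened Coulomb potential (the sign and the normalisation, e.g. $\lambda=\pm1$ or $\lambda=\pm\frac1{4\pi}$, are contained in $\lambda$). Fix $c\in(\frac75,\frac32)$, put $a=\frac3c-1$, and let $B_0>0$. For $T>0$ and a magnetic field $B:[0,T]\times\mathbb R^3\to\mathbb R^3$ consider $$\partial_t f+v\cdot\nabla_xf-(\nabla K\star\rho_f+v\wedge B)\cdot\nabla_vf=0,\qquad \rho_f(t,x)=\int_{\mathbb R^3}f(t,x,v)\,dv,\qquad f|_{t=0}=f^{\mathrm{in}} .$$ A classical solution on $[0,T]$ is a function $f\ge0$ that is continuous on $[0,T]\times\mathbb R^3\times\mathbb R^3$ and $C^1$ on $(0,T)\times\mathbb R^3\times\mathbb R^3$, with $f(t,\cdot,\cdot)\in L^1\cap L^\infty(\mathbb R^3\times\mathbb R^3)$ for each $t\in[0,T]$, for which the integrals defining $\rho_f(t,x)$ and $(\nabla K\star\rho_f)(t,x)$ converge absolutely at every $(t,x)\in[0,T]\times\mathbb R^3$,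 the field $\nabla K\star\rho_f$ is bounded on $[0,T]\times\mathbb R^3$, the equation holds pointwise on $(0,T)\times\mathbb R^3\times\mathbb R^3$, and $f(0,\cdot,\cdot)=f^{\mathrm{in}}$. Write $$M_n(t)=\int_{\mathbb R^6}|v|^nf\,dx\,dv,\qquad N_n(t)=\int_{\mathbb R^6}|x|^nf\,dx\,dv,\qquad L_n(t)=\int_{\mathbb R^6}|x-tv|^nf(t,x,v)\,dx\,dv,$$ and $\|g\|_{L^1\cap L^\infty}=\|g\|_{L^1}+\|g\|_{L^\infty}$. **Theorem.** There are a constant $\varepsilon_0>0$ and a function $\Phi(A,M,N,t)$, continuous in $t$, both depending only on $\kappa,\lambda,c,B_0$, such that the following holds. Let $T>0$ and let $B$ satisfy $$\textbf{(B)}\qquad \|x\wedge B(t,x)\|_{L^\infty_x}\le B_0t^{-a},\qquad \|B(t,\cdot)\|_{L^\infty}\le B_0t^{-a}\qquad(0<t\le T).$$ Let $0\le f^{\mathrm{in}}\in L^1\cap L^\infty(\mathbb R^3\times\mathbb R^3)$, let $M_k(0)\le\mathbf M_k^{\mathrm{in}}$ and $N_k(0)\le\mathbf N_k^{\mathrm{in}}$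 with constants $\mathbf M_k^{\mathrm{in}},\mathbf N_k^{\mathrm{in}}>0$ for $0\le k\le4$, and suppose that $$\|f^{\mathrm{in}}\|_{L^1\cap L^\infty}+M_4(0)+N_4(0)\le\varepsilon_0 .$$ Then every classical solution $f$ on $[0,T]$ with initial value $f^{\mathrm{in}}$ satisfies $$L_4(t)\le\Phi\big(\|f^{\mathrm{in}}\|_{L^1\cap L^\infty},\mathbf M_4^{\mathrm{in}},\mathbf N_4^{\mathrm{in}},t\big)\qquad\text{for all }t\in[0,T].$$ -/

import Mathlib

open MeasureTheory Set
open scoped ENNReal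

noncomputable section

namespace ScreenedVlasov

/-- Physical space (and velocity space) `ℝ³` with the Euclidean norm and Lebesgue measure. -/
abbrev E3 : Type := EuclideanSpace ℝ (Fin 3)

/-- The vector product `u ∧ w` on `ℝ³`. -/
def wedge (u w : E3) : E3 :=
  WithLp.toLp 2 (crossProduct (WithLp.ofLp u) (WithLp.ofLp w))

/-- The screened Coulomb (Yukawa) potential `K(x) = lam * exp (-κ |x|) / |x|`.
The sign and the normalisation are in the constant `lam`. -/
def screenedPotential (κ lam : ℝ) (x : E3) : ℝ :=
  lam * (Real.exp (-κ * ‖x‖) / ‖x‖)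

/-- The spatial density `ρ_g(x) = ∫ g(x, v) dv` of a phase space density `g`. -/
def density (g : E3 → E3 → ℝ) (x : E3) : ℝ :=
  ∫ v, g x v

/-- The field `(∇K ⋆ ρ_g)(x) = ∫ ∇K(x - y) ρ_g(y) dy`. -/
def field (κ lam : ℝ) (g : E3 → E3 → ℝ) (x : E3) : E3 :=
  ∫ y, density g y • gradient (screenedPotential κ lam) (x - y)

/-- The velocity moment `M_n = ∫ |v|^n g(x, v) dx dv`, with value in `[0, ∞]`. -/
def velocityMoment (n : ℕ) (g : E3 → E3 → ℝ) : ℝ≥0∞ :=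
  ∫⁻ z : E3 × E3, ENNReal.ofReal (‖z.2‖ ^ n * g z.1 z.2)

/-- The position moment `N_n = ∫ |x|^n g(x, v) dx dv`, with value in `[0, ∞]`. -/
def positionMoment (n : ℕ) (g : E3 → E3 → ℝ) : ℝ≥0∞ :=
  ∫⁻ z : E3 × E3, ENNReal.ofReal (‖z.1‖ ^ n * g z.1 z.2)

/-- The Eulerian moment `L_n = ∫ |x - t v|^n g(x, v) dx dv`, with value in `[0, ∞]`. -/
def eulerianMoment (n : ℕ) (t : ℝ) (g : E3 → E3 → ℝ) : ℝ≥0∞ :=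
  ∫⁻ z : E3 × E3, ENNReal.ofReal (‖z.1 - t • z.2‖ ^ n * g z.1 z.2)

/-- `g ∈ L¹ ∩ L^∞(ℝ³ × ℝ³)`. -/
def MemL1Linf (g : E3 → E3 → ℝ) : Prop :=
  MemLp (fun z : E3 × E3 => g z.1 z.2) 1 volume ∧
    MemLp (fun z : E3 × E3 => g z.1 z.2) ∞ volume

/-- The norm `‖g‖_{L¹ ∩ L^∞} = ‖g‖_{L¹} + ‖g‖_{L^∞}` on `ℝ³ × ℝ³`, with value in `[0, ∞]`. -/
def normL1Linf (g : E3 → E3 → ℝ) : ℝ≥0∞ :=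
  eLpNorm (fun z : E3 × E3 => g z.1 z.2) 1 volume +
    eLpNorm (fun z : E3 × E3 => g z.1 z.2) ∞ volume

/-- The decay hypothesis on the magnetic field: with `a = 3 / c - 1` and `b(t, x) = x ∧ B(t, x)`,
`‖b(t, ·)‖_∞ ≤ B₀ t^{-a}` and `‖B(t, ·)‖_∞ ≤ B₀ t^{-a}` for `0 < t ≤ T`. -/
structure MagneticDecay (c B₀ T : ℝ) (B : ℝ → E3 → E3) : Prop where
  aestronglyMeasurable : ∀ t ∈ Ioc 0 T, AEStronglyMeasurable (B t) volume
  bound_b : ∀ t ∈ Ioc 0 T,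
    eLpNorm (fun x => wedge x (B t x)) ∞ volume ≤ ENNReal.ofReal (B₀ * t ^ (-(3 / c - 1)))
  bound_B : ∀ t ∈ Ioc 0 T,
    eLpNorm (B t) ∞ volume ≤ ENNReal.ofReal (B₀ * t ^ (-(3 / c - 1)))

/-- `f` is a classical solution on `[0, T]` of the magnetized screened Vlasov-Poisson equation
`∂_t f + v · ∇_x f - (∇K ⋆ ρ_f + v ∧ B) · ∇_v f = 0` with initial value `fin`:
a nonnegative function, bounded and integrable on phase space at each time, continuous on
`[0, T] × ℝ³ × ℝ³` and continuously differentiable on `(0, T) × ℝ³ × ℝ³`, whose density and field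
exist everywhere, whose field is bounded on `[0, T] × ℝ³`, and which satisfies the equation
pointwise. -/
structure IsClassicalSolution (κ lam T : ℝ) (B : ℝ → E3 → E3) (fin : E3 → E3 → ℝ)
    (f : ℝ → E3 → E3 → ℝ) : Prop where
  nonneg : ∀ t ∈ Icc 0 T, ∀ x v, 0 ≤ f t x v
  memL1Linf : ∀ t ∈ Icc 0 T, MemL1Linf (f t)
  continuousOn :
    ContinuousOn (fun p : ℝ × E3 × E3 => f p.1 p.2.1 p.2.2) (Icc 0 T ×ˢ univ)
  contDiffOn :
    ContDiffOn ℝ 1 (fun p : ℝ × E3 × E3 => f p.1 p.2.1 p.2.2) (Ioo 0 T ×ˢ univ)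
  density_exists : ∀ t ∈ Icc 0 T, ∀ x, Integrable (fun v => f t x v)
  field_exists : ∀ t ∈ Icc 0 T, ∀ x,
    Integrable (fun y => density (f t) y • gradient (screenedPotential κ lam) (x - y))
  field_bounded : ∃ C : ℝ, ∀ t ∈ Icc 0 T, ∀ x, ‖field κ lam (f t) x‖ ≤ C
  equation : ∀ t ∈ Ioo 0 T, ∀ x v,
    deriv (fun s => f s x v) t
      + inner ℝ v (gradient (fun y => f t y v) x)
      - inner ℝ (field κ lam (f t) x + wedge v (B t x)) (gradient (fun w => f t x w) v) = 0
  initial : ∀ x v, f 0 x v = fin x v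

end ScreenedVlasov

end

/-! Write `q = 3 / c - 1`, so `1 < q < 8 / 7`, and let `E = ∇K ⋆ ρ`. The proof is a bootstrap for a
fourth moment, with two different weights before and after time `1`; the function `Φ` can be taken
to be the constant `1`.

For `t ≥ 1` the weight is `|y|^4` with `y = x - t v`. Along characteristics `y` has derivative `t (E
+ v ∧ B)`. Since `y · (y ∧ B) = 0`, one has `t y · (v ∧ B) = y · (x ∧ B)`, so the magnetic field
enters only through `x ∧ B`, which is bounded by `B₀ t^(-q)` (`fderiv_lateWeight_le`). For `t ≤ 1`
that bound is not integrable at `0`, and the weight is `e^(-4t) (|x|^4 + |v|^4)` instead: the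
magnetic force does no work and drops out entirely (`fderiv_earlyWeight_le`).

The self-consistent field is handled by `lintegral_interaction_le`. With `m(x) = ∫ |y|^4 f dv`,
interpolation against `‖f‖_∞` bounds the density by `m^(3/7)` and the third moment by `m^(6/7)`.
Young's inequality with `∇K ∈ L^(7/5)` then closes the estimate, because `5/7 + 3/7 + 6/7 = 2`. The
local singularity `|z|^(-2)` is admissible as `14/5 < 3`, and the screening gives integrability at
infinity. For the late weight the velocity balls have volume of order `t^(-3)`, so the interaction
term decays like `t · t^(-15/7) = t^(-8/7) ≤ t^(-q)`. Everything is thus integrable over `[1, ∞)`.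

The interaction coefficient is small because `‖f‖_∞` is. The magnetic coefficient `B₀` need not be
small, so `|y|^3` is split as `η |y|^4 + η^(-3)`: the first part is small by the choice of `η`, the
second is multiplied by the small mass. A continuity argument (`le_of_increment_le`) then keeps the
moment below its threshold.

The moment inequalities are justified for classical solutions in `IsTransported.lintegral_le`, by
testing with phase space cutoffs that decrease along characteristics; boundedness of the field makes
such cutoffs available and also yields finiteness of the moments beforehand. -/

noncomputable section
namespace ScreenedVlasov

open Filter Topology

/-! ### Interpolation between the supremum of a density and its fourth moment -/

section Interpolation

variable {V : Type*} [MeasurableSpace V] {μ : Measure V} {q g : V → ℝ≥0∞}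

/-- Below the level `R` the weight is at most `R^k`; above it, `1 ≤ (q / R)^(4 - k)` converts the
weight into a fourth power. -/
lemma lintegral_pow_mul_le_split (hq : Measurable q) {A : ℝ≥0∞}
    (hA : ∀ᵐ v ∂μ, g v ≤ A) {k : ℕ} (hk : k ≤ 4) {R : ℝ≥0∞} (hR0 : R ≠ 0) (hRt : R ≠ ⊤) :
    ∫⁻ v, q v ^ k * g v ∂μ ≤
      R ^ k * A * μ {v | q v ≤ R} + R⁻¹ ^ (4 - k) * ∫⁻ v, q v ^ 4 * g v ∂μ := by
  have hS : MeasurableSet {v | q v ≤ R} := hq measurableSet_Iic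
  have hRi : R⁻¹ ^ (4 - k) ≠ ⊤ := ENNReal.pow_ne_top (ENNReal.inv_ne_top.2 hR0)
  rw [← lintegral_const_mul' _ _ hRi, ← lintegral_indicator_const hS,
    ← lintegral_add_left (measurable_const.indicator hS)]
  refine lintegral_mono_ae ?_
  filter_upwards [hA] with v hv
  by_cases h : q v ≤ R
  · rw [indicator_of_mem (by exact h)]
    exact le_add_right (by gcongr)
  · rw [indicator_of_notMem (by exact h), zero_add]
    have h1 : 1 ≤ R⁻¹ * q v := by
      rw [mul_comm, ← div_eq_mul_inv, ENNReal.le_div_iff_mul_le (Or.inl hR0) (Or.inl hRt), one_mul]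
      exact (not_le.1 h).le
    calc q v ^ k * g v = 1 * (q v ^ k * g v) := (one_mul _).symm
      _ ≤ (R⁻¹ * q v) ^ (4 - k) * (q v ^ k * g v) := by gcongr; exact one_le_pow₀ h1
      _ = R⁻¹ ^ (4 - k) * (q v ^ (4 - k + k) * g v) := by rw [mul_pow, pow_add]; ring
      _ = _ := by rw [Nat.sub_add_cancel hk]

/-- Interpolation of a weighted moment between the supremum of the density and its fourth
moment. -/
lemma lintegral_pow_mul_le_interpolation (hq : Measurable q) {a b : ℝ} (ha : 0 < a) (hb : 0 < b)
    (hA : ∀ᵐ v ∂μ, g v ≤ ENNReal.ofReal (a ^ 7)) {C : ℝ≥0∞} (hC : C ≠ ⊤)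
    (hvol : ∀ R : ℝ, 0 < R → μ {v | q v ≤ ENNReal.ofReal R} ≤ C * ENNReal.ofReal (R ^ 3 / b ^ 7))
    {k : ℕ} (hk : k ≤ 3) :
    ∫⁻ v, q v ^ k * g v ∂μ ≤
      (C + 1) * ENNReal.ofReal ((a / b) ^ (4 - k)) *
        (∫⁻ v, q v ^ 4 * g v ∂μ) ^ ((k + 3 : ℝ) / 7) := by
  set I := ∫⁻ v, q v ^ 4 * g v ∂μ with hI
  have key : ∀ m : ℝ, 0 < m → I ≤ ENNReal.ofReal (m ^ 7) → ∫⁻ v, q v ^ k * g v ∂μ ≤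
      (C + 1) * ENNReal.ofReal ((a / b) ^ (4 - k)) * ENNReal.ofReal (m ^ (k + 3)) := by
    intro m hm hIm
    -- This level balances the two terms of the splitting: both become multiples of `(a / b)^(4 - k)
    -- * m^(k + 3)`. Seventh powers of `a`, `b`, `m` keep these exponents integral.
    have hR : 0 < m * b / a := by positivity
    refine (lintegral_pow_mul_le_split hq hA (by omega : k ≤ 4) (R := ENNReal.ofReal (m * b / a))
      (by simpa using hR) ENNReal.ofReal_ne_top).trans ?_
    have e1 : (m * b / a) ^ k * a ^ 7 * ((m * b / a) ^ 3 / b ^ 7) =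
        (a / b) ^ (4 - k) * m ^ (k + 3) := by
      interval_cases k <;> norm_num <;> field_simp
    have e2 : ((m * b / a)⁻¹) ^ (4 - k) * m ^ 7 = (a / b) ^ (4 - k) * m ^ (k + 3) := by
      interval_cases k <;> norm_num <;> field_simp
    calc _ ≤ ENNReal.ofReal (m * b / a) ^ k * ENNReal.ofReal (a ^ 7) *
            (C * ENNReal.ofReal ((m * b / a) ^ 3 / b ^ 7)) +
          (ENNReal.ofReal (m * b / a))⁻¹ ^ (4 - k) * ENNReal.ofReal (m ^ 7) := by
            gcongr
            exact hvol _ hR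
      _ = C * ENNReal.ofReal ((m * b / a) ^ k * a ^ 7 * ((m * b / a) ^ 3 / b ^ 7)) +
          ENNReal.ofReal (((m * b / a)⁻¹) ^ (4 - k) * m ^ 7) := by
            rw [ENNReal.ofReal_mul (by positivity), ENNReal.ofReal_mul (by positivity),
              ENNReal.ofReal_mul (by positivity), ENNReal.ofReal_pow hR.le,
              ENNReal.ofReal_pow (inv_nonneg.2 hR.le), ENNReal.ofReal_inv_of_pos hR]
            ring
      _ = _ := by
            rw [e1, e2, ENNReal.ofReal_mul (by positivity)]
            ring
  rcases eq_or_ne I ⊤ with hIt | hIt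
  · rw [hIt, ENNReal.top_rpow_of_pos (by positivity), ENNReal.mul_top]
    · exact le_top
    · have : 0 < (a / b) ^ (4 - k) := by positivity
      simp [this]
  · set m₀ := (I ^ (1 / 7 : ℝ)).toReal with hm₀
    have hm₀I : I ^ (1 / 7 : ℝ) = ENNReal.ofReal m₀ :=
      (ENNReal.ofReal_toReal (ENNReal.rpow_ne_top_of_nonneg (by norm_num) hIt)).symm
    have hm₀0 : 0 ≤ m₀ := ENNReal.toReal_nonneg
    have hI7 : I = ENNReal.ofReal (m₀ ^ 7) := by
      rw [ENNReal.ofReal_pow hm₀0, ← hm₀I, ← ENNReal.rpow_natCast, ← ENNReal.rpow_mul]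
      norm_num
    have hIk : I ^ ((k + 3 : ℝ) / 7) = ENNReal.ofReal (m₀ ^ (k + 3)) := by
      rw [ENNReal.ofReal_pow hm₀0, ← hm₀I, ← ENNReal.rpow_natCast, ← ENNReal.rpow_mul]
      congr 1
      push_cast
      ring
    rw [hIk]
    -- `key` needs `m > 0`, so the value `m₀ = I^(1/7)`, possibly zero, is reached as a limit from
    -- the right.
    have hlim : Tendsto (fun m : ℝ => (C + 1) * ENNReal.ofReal ((a / b) ^ (4 - k)) *
        ENNReal.ofReal (m ^ (k + 3))) (𝓝[>] m₀) (𝓝 ((C + 1) * ENNReal.ofReal ((a / b) ^ (4 - k)) *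
        ENNReal.ofReal (m₀ ^ (k + 3)))) := by
      refine ENNReal.Tendsto.const_mul ?_ (Or.inr (ENNReal.mul_ne_top (by simp [hC])
        ENNReal.ofReal_ne_top))
      refine Tendsto.mono_left ?_ nhdsWithin_le_nhds
      exact (ENNReal.continuous_ofReal.comp (continuous_pow _)).tendsto m₀
    refine ge_of_tendsto hlim ?_
    filter_upwards [self_mem_nhdsWithin] with m hm
    have hm' : m₀ < m := hm
    refine key m (hm₀0.trans_lt hm') ?_
    rw [hI7]
    gcongr

end Interpolation

/-- The Hölder estimate behind the interaction term: the exponents are those of Young's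
inequality. -/
lemma lintegral_lintegral_convolution_le {X : Type*} [AddCommGroup X] [MeasurableSpace X]
    [MeasurableAdd₂ X] [MeasurableNeg X] [MeasurableSub₂ X] {μ : Measure X} [SFinite μ]
    [μ.IsAddLeftInvariant] [μ.IsNegInvariant] [μ.IsAddRightInvariant]
    {k g : X → ℝ≥0∞} (hk : Measurable k) (hg : Measurable g) :
    ∫⁻ x, ∫⁻ y, k (x - y) * g y ^ (3 / 7 : ℝ) * g x ^ (6 / 7 : ℝ) ∂μ ∂μ ≤
      (∫⁻ z, k z ^ (7 / 5 : ℝ) ∂μ) ^ (5 / 7 : ℝ) * (∫⁻ x, g x ∂μ) ^ (9 / 7 : ℝ) := by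
  set G := ∫⁻ x, g x ∂μ
  set κ := ∫⁻ z, k z ^ (7 / 5 : ℝ) ∂μ
  have hkm : Measurable fun z : X × X => k (z.1 - z.2) := hk.comp measurable_sub
  have hkm' : Measurable fun z : X × X => k (z.1 - z.2) ^ (7 / 5 : ℝ) := hkm.pow_const _
  have h1 : Measurable fun z : X × X => g z.1 := hg.comp measurable_fst
  have h2 : Measurable fun z : X × X => g z.2 := hg.comp measurable_snd
  rw [← lintegral_prod (f := fun z : X × X =>
    k (z.1 - z.2) * g z.2 ^ (3 / 7 : ℝ) * g z.1 ^ (6 / 7 : ℝ))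
    ((hkm.mul (h2.pow_const _)).mul (h1.pow_const _)).aemeasurable]
  -- With Hölder weights `1/7, 4/7, 2/7` the kernel gets the power `7/5 · (1/7 + 4/7) = 1`, `g y`
  -- gets `1/7 + 2/7` and `g x` gets `4/7 + 2/7`. Each factor integrates explicitly by translation
  -- invariance.
  let F : Fin 3 → X × X → ℝ≥0∞ := ![fun z => k (z.1 - z.2) ^ (7 / 5 : ℝ) * g z.2,
    fun z => k (z.1 - z.2) ^ (7 / 5 : ℝ) * g z.1, fun z => g z.1 * g z.2]
  let p : Fin 3 → ℝ := ![1 / 7, 4 / 7, 2 / 7]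
  have hF : ∀ i ∈ Finset.univ, AEMeasurable (F i) (μ.prod μ) := by
    intro i _
    fin_cases i
    · exact (hkm'.mul h2).aemeasurable
    · exact (hkm'.mul h1).aemeasurable
    · exact (h1.mul h2).aemeasurable
  have H := ENNReal.lintegral_prod_norm_pow_le (μ := μ.prod μ) Finset.univ hF (p := p)
    (by simp [Fin.sum_univ_three, p]; norm_num)
    (by intro i _; fin_cases i <;> norm_num [p])
  simp only [Fin.prod_univ_three, F, p, Matrix.cons_val_zero, Matrix.cons_val_one,
    Matrix.cons_val_two, Matrix.head_cons, Matrix.tail_cons] at H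
  have i1 : ∫⁻ z, k (z.1 - z.2) ^ (7 / 5 : ℝ) * g z.2 ∂(μ.prod μ) = κ * G := by
    rw [lintegral_prod_symm (fun z : X × X => k (z.1 - z.2) ^ (7 / 5 : ℝ) * g z.2)
      (hkm'.mul h2).aemeasurable, ← lintegral_const_mul _ hg]
    refine lintegral_congr fun y => ?_
    refine (lintegral_mul_const (g y) (f := fun x => k (x - y) ^ (7 / 5 : ℝ))
      (hkm'.comp measurable_prodMk_right)).trans ?_
    congr 1
    exact lintegral_sub_right_eq_self (fun z => k z ^ (7 / 5 : ℝ)) y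
  have i2 : ∫⁻ z, k (z.1 - z.2) ^ (7 / 5 : ℝ) * g z.1 ∂(μ.prod μ) = κ * G := by
    rw [lintegral_prod (fun z : X × X => k (z.1 - z.2) ^ (7 / 5 : ℝ) * g z.1)
      (hkm'.mul h1).aemeasurable, ← lintegral_const_mul _ hg]
    refine lintegral_congr fun x => ?_
    refine (lintegral_mul_const (g x) (f := fun y => k (x - y) ^ (7 / 5 : ℝ))
      (hkm'.comp measurable_prodMk_left)).trans ?_
    congr 1
    exact lintegral_sub_left_eq_self (fun z => k z ^ (7 / 5 : ℝ)) x
  have i3 : ∫⁻ z, g z.1 * g z.2 ∂(μ.prod μ) = G * G := by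
    rw [lintegral_prod_mul hg.aemeasurable hg.aemeasurable]
  rw [i1, i2, i3] at H
  have hmulr : ∀ (a b : ℝ≥0∞) {r : ℝ}, 0 ≤ r → (a * b) ^ r = a ^ r * b ^ r :=
    fun a b r hr => ENNReal.mul_rpow_of_nonneg a b hr
  calc _ = _ := lintegral_congr fun z => ?_
    _ ≤ _ := H
    _ = _ := ?_
  · rw [hmulr _ _ (by norm_num), hmulr _ _ (by norm_num), hmulr _ _ (by norm_num),
      ← ENNReal.rpow_mul, ← ENNReal.rpow_mul]
    have a1 : k (z.1 - z.2) = k (z.1 - z.2) ^ (7 / 5 * (1 / 7) : ℝ) *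
        k (z.1 - z.2) ^ (7 / 5 * (4 / 7) : ℝ) := by
      rw [← ENNReal.rpow_add_of_nonneg _ _ (by norm_num) (by norm_num)]; norm_num
    have a2 : g z.2 ^ (3 / 7 : ℝ) = g z.2 ^ (1 / 7 : ℝ) * g z.2 ^ (2 / 7 : ℝ) := by
      rw [← ENNReal.rpow_add_of_nonneg _ _ (by norm_num) (by norm_num)]; norm_num
    have a3 : g z.1 ^ (6 / 7 : ℝ) = g z.1 ^ (4 / 7 : ℝ) * g z.1 ^ (2 / 7 : ℝ) := by
      rw [← ENNReal.rpow_add_of_nonneg _ _ (by norm_num) (by norm_num)]; norm_num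
    rw [a2, a3]
    nth_rw 1 [a1]
    ring
  · rw [hmulr _ _ (by norm_num), hmulr _ _ (by norm_num), hmulr _ _ (by norm_num)]
    have b1 : κ ^ (5 / 7 : ℝ) = κ ^ (1 / 7 : ℝ) * κ ^ (4 / 7 : ℝ) := by
      rw [← ENNReal.rpow_add_of_nonneg _ _ (by norm_num) (by norm_num)]; norm_num
    have b2 : G ^ (9 / 7 : ℝ) = G ^ (1 / 7 : ℝ) * G ^ (4 / 7 : ℝ) *
        (G ^ (2 / 7 : ℝ) * G ^ (2 / 7 : ℝ)) := by
      rw [← ENNReal.rpow_add_of_nonneg _ _ (by norm_num) (by norm_num),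
        ← ENNReal.rpow_add_of_nonneg _ _ (by norm_num) (by norm_num),
        ← ENNReal.rpow_add_of_nonneg _ _ (by norm_num) (by norm_num)]; norm_num
    rw [b1, b2]
    ring


/-! ### Size and integrability of the gradient of the screened potential -/

section Kernel

variable (κ lam : ℝ)

lemma measurable_gradient_screenedPotential :
    Measurable (gradient (screenedPotential κ lam)) :=
  (InnerProductSpace.toDual ℝ E3).symm.continuous.measurable.comp
    (measurable_fderiv ℝ (screenedPotential κ lam))

variable {κ}

/-- The radial derivative has modulus `|lam| (κ r + 1) e^(-κ r) / r^2`, and half of the exponential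
absorbs the linear factor. -/
lemma norm_gradient_screenedPotential_le (hκ : 0 < κ) {z : E3} (hz : z ≠ 0) :
    ‖gradient (screenedPotential κ lam) z‖ ≤
      2 * |lam| * (Real.exp (-(κ / 2) * ‖z‖) / ‖z‖ ^ 2) := by
  have hr : 0 < ‖z‖ := norm_pos_iff.2 hz
  have hh : HasDerivAt (fun r : ℝ => lam * (Real.exp (-κ * r) / r))
      (lam * ((Real.exp (-κ * ‖z‖) * (-κ) * ‖z‖ - Real.exp (-κ * ‖z‖) * 1) / ‖z‖ ^ 2)) ‖z‖ := by
    refine HasDerivAt.const_mul _ (HasDerivAt.div ?_ (hasDerivAt_id _) hr.ne')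
    have := ((hasDerivAt_id ‖z‖).const_mul (-κ)).exp
    simpa using this
  have hn : HasFDerivAt (fun y : E3 => ‖y‖) (fderiv ℝ (fun y : E3 => ‖y‖) z) z :=
    ((contDiffAt_norm ℝ hz).differentiableAt (by simp : (1 : WithTop ℕ∞) ≠ 0)).hasFDerivAt
  have hK : HasFDerivAt (screenedPotential κ lam) _ z := hh.comp_hasFDerivAt z hn
  have hnorm : ‖fderiv ℝ (fun y : E3 => ‖y‖) z‖ ≤ 1 := by
    have := norm_fderiv_le_of_lipschitz ℝ (x₀ := z) (lipschitzWith_one_norm (E := E3))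
    simpa using this
  rw [gradient, LinearIsometryEquiv.norm_map, hK.fderiv, norm_smul]
  refine (mul_le_mul_of_nonneg_left hnorm (norm_nonneg _)).trans ?_
  rw [mul_one, Real.norm_eq_abs, abs_mul, abs_div, abs_of_pos (pow_pos hr 2)]
  have e1 : |Real.exp (-κ * ‖z‖) * (-κ) * ‖z‖ - Real.exp (-κ * ‖z‖) * 1| =
      Real.exp (-κ * ‖z‖) * (κ * ‖z‖ + 1) := by
    rw [← abs_neg, abs_of_nonneg]
    · ring
    · have := Real.exp_pos (-κ * ‖z‖)
      have : 0 ≤ Real.exp (-κ * ‖z‖) * (κ * ‖z‖ + 1) := by positivity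
      linarith
  have e2 : Real.exp (-κ * ‖z‖) * (κ * ‖z‖ + 1) ≤ 2 * Real.exp (-(κ / 2) * ‖z‖) := by
    have h1 := Real.add_one_le_exp (κ / 2 * ‖z‖)
    have h2 : Real.exp (-(κ / 2) * ‖z‖) = Real.exp (-κ * ‖z‖) * Real.exp (κ / 2 * ‖z‖) := by
      rw [← Real.exp_add]; ring_nf
    rw [h2]
    nlinarith [Real.exp_pos (-κ * ‖z‖)]
  rw [e1]
  calc _ ≤ |lam| * (2 * Real.exp (-(κ / 2) * ‖z‖) / ‖z‖ ^ 2) := by gcongr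
    _ = _ := by ring

/-- In polar coordinates the integrand is `r^(2 - 14/5) = r^(-4/5)` times an exponential: integrable
at `0`, and at infinity thanks to `κ > 0`. -/
lemma lintegral_gradient_screenedPotential_lt_top (hκ : 0 < κ) :
    ∫⁻ z : E3, ‖gradient (screenedPotential κ lam) z‖ₑ ^ (7 / 5 : ℝ) < ⊤ := by
  let φ : ℝ → ℝ := fun r => (2 * |lam| * (Real.exp (-(κ / 2) * r) / r ^ 2)) ^ (7 / 5 : ℝ)
  have hφ : Integrable (fun z : E3 => φ ‖z‖) := by
    rw [integrable_fun_norm_addHaar]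
    have h := (integrableOn_rpow_mul_exp_neg_mul_rpow (p := 1) (s := -(4 / 5)) (b := 7 / 10 * κ)
      (by norm_num) one_pos (by positivity)).const_mul ((2 * |lam|) ^ (7 / 5 : ℝ))
    refine h.congr ?_
    filter_upwards [ae_restrict_mem measurableSet_Ioi] with r hr
    have hr : 0 < r := hr
    simp only [φ, finrank_euclideanSpace, Fintype.card_fin, smul_eq_mul]
    rw [Real.mul_rpow (x := 2 * |lam|) (by positivity) (by positivity), Real.div_rpow (by positivity)
      (by positivity), ← Real.exp_mul, ← Real.rpow_natCast r 2, ← Real.rpow_mul hr.le, Real.rpow_one]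
    have : r ^ (-(4 / 5) : ℝ) = r ^ ((2 : ℕ) : ℝ) / r ^ (((2 : ℕ) : ℝ) * (7 / 5)) := by
      rw [← Real.rpow_sub hr]; norm_num
    rw [this]
    have : -(7 / 10 * κ) * r = -(κ / 2) * r * (7 / 5) := by ring
    rw [this]
    ring
  refine lt_of_le_of_lt (lintegral_mono_ae ?_) hφ.lintegral_lt_top
  have h0 : ∀ᵐ z : E3, z ≠ 0 := by
    simp [ae_iff, measure_singleton]
  filter_upwards [h0] with z hz
  rw [← ofReal_norm, ENNReal.ofReal_rpow_of_nonneg (norm_nonneg _) (by norm_num)]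
  refine ENNReal.ofReal_le_ofReal ?_
  exact Real.rpow_le_rpow (norm_nonneg _) (norm_gradient_screenedPotential_le lam hκ hz)
    (by norm_num)

end Kernel

/-- The set lies in a ball of radius `R / |β|`. With `β = -t` this is the dispersive gain: its
volume shrinks like `t^(-3)`. -/
lemma volume_norm_add_smul_le (x : E3) {β b : ℝ} (hb : 0 < b) (hβ : |β| ^ 3 = b ^ 7)
    {R : ℝ} (hR : 0 < R) :
    volume {v : E3 | ‖x + β • v‖ₑ ≤ ENNReal.ofReal R} ≤
      volume (Metric.ball (0 : E3) 1) * ENNReal.ofReal (R ^ 3 / b ^ 7) := by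
  have hβ0 : 0 < |β| := by
    rcases (abs_nonneg β).lt_or_eq with h | h
    · exact h
    · rw [← h] at hβ
      have : 0 < b ^ 7 := by positivity
      norm_num at hβ
      linarith
  have hβ1 : β ≠ 0 := abs_pos.1 hβ0
  have hsub : {v : E3 | ‖x + β • v‖ₑ ≤ ENNReal.ofReal R} ⊆
      Metric.closedBall (-(β⁻¹ • x)) (R / |β|) := by
    intro v hv
    have hv : ‖x + β • v‖ₑ ≤ ENNReal.ofReal R := hv
    rw [← ofReal_norm, ENNReal.ofReal_le_ofReal_iff hR.le] at hv
    rw [mem_closedBall_iff_norm, le_div_iff₀ hβ0, mul_comm, ← Real.norm_eq_abs, ← norm_smul]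
    rwa [sub_neg_eq_add, smul_add, smul_smul, mul_inv_cancel₀ hβ1, one_smul, add_comm]
  refine (measure_mono hsub).trans ?_
  rw [Measure.addHaar_closedBall _ _ (by positivity), mul_comm]
  simp only [finrank_euclideanSpace, Fintype.card_fin, div_pow, hβ]
  exact le_rfl

/-! ### The interaction estimate -/

section Interaction

variable {u : E3 → E3 → ℝ}

lemma density_measurable (hu : Continuous (Function.uncurry u)) : Measurable (density u) :=
  (hu.stronglyMeasurable.integral_prod_right (ν := volume)).measurable

lemma field_measurable (κ lam : ℝ) (hu : Continuous (Function.uncurry u)) :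
    Measurable (field κ lam u) := by
  have h : Measurable fun p : E3 × E3 =>
      density u p.2 • gradient (screenedPotential κ lam) (p.1 - p.2) :=
    ((density_measurable hu).comp measurable_snd).smul
      ((measurable_gradient_screenedPotential κ lam).comp measurable_sub)
  exact (h.stronglyMeasurable.integral_prod_right (ν := volume)).measurable

lemma enorm_field_le (κ lam : ℝ) (u : E3 → E3 → ℝ) (x : E3) :
    ‖field κ lam u x‖ₑ ≤ ∫⁻ y, ‖gradient (screenedPotential κ lam) (x - y)‖ₑ *
      ∫⁻ v, ‖u y v‖ₑ := by
  refine (enorm_integral_le_lintegral_enorm _).trans (lintegral_mono fun y => ?_)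
  rw [enorm_smul, mul_comm]
  gcongr
  exact enorm_integral_le_lintegral_enorm _

/-- The constant of the interaction estimate. -/
def interactionConst (κ lam : ℝ) : ℝ≥0∞ :=
  (volume (Metric.ball (0 : E3) 1) + 1) ^ 2 *
    (∫⁻ z : E3, ‖gradient (screenedPotential κ lam) z‖ₑ ^ (7 / 5 : ℝ)) ^ (5 / 7 : ℝ)

lemma interactionConst_ne_top {κ : ℝ} (hκ : 0 < κ) (lam : ℝ) : interactionConst κ lam ≠ ⊤ := by
  refine ENNReal.mul_ne_top (ENNReal.pow_ne_top ?_) (ENNReal.rpow_ne_top_of_nonneg (by norm_num)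
    (lintegral_gradient_screenedPotential_lt_top lam hκ).ne)
  exact ENNReal.add_ne_top.2 ⟨measure_ball_lt_top.ne, ENNReal.one_ne_top⟩

/-- The case `k = 0` of the interpolation bounds the density inside the field, the case `k = 3`
bounds the weighted integral in `v`; their factors `(a / b)^4` and `a / b` combine to the fifth
power, and the convolution estimate does the rest. The parameters `α, β` cover both `v` and `x - t
v`. -/
lemma lintegral_interaction_le (κ lam : ℝ) (hu : Continuous (Function.uncurry u))
    {a b α β : ℝ} (ha : 0 < a) (hb : 0 < b) (hβ : |β| ^ 3 = b ^ 7)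
    (hA : ∀ x v, ‖u x v‖ₑ ≤ ENNReal.ofReal (a ^ 7)) :
    ∫⁻ z : E3 × E3, ‖α • z.1 + β • z.2‖ₑ ^ 3 * ‖field κ lam u z.1‖ₑ * ‖u z.1 z.2‖ₑ ≤
      interactionConst κ lam * ENNReal.ofReal ((a / b) ^ 5) *
        (∫⁻ z : E3 × E3, ‖α • z.1 + β • z.2‖ₑ ^ 4 * ‖u z.1 z.2‖ₑ) ^ (9 / 7 : ℝ) := by
  set V := volume (Metric.ball (0 : E3) 1) with hV
  have hVt : V ≠ ⊤ := measure_ball_lt_top.ne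
  have hum : Measurable (Function.uncurry u) := hu.measurable
  have hum' : Measurable fun z : E3 × E3 => ‖u z.1 z.2‖ₑ := hum.enorm
  have hqm : Measurable fun z : E3 × E3 => ‖α • z.1 + β • z.2‖ₑ := by fun_prop
  set m : E3 → ℝ≥0∞ := fun x => ∫⁻ v, ‖α • x + β • v‖ₑ ^ 4 * ‖u x v‖ₑ with hm
  have hmm : Measurable m := ((hqm.pow_const 4).mul hum').lintegral_prod_right'
  have hG : ∫⁻ z : E3 × E3, ‖α • z.1 + β • z.2‖ₑ ^ 4 * ‖u z.1 z.2‖ₑ = ∫⁻ x, m x := by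
    rw [Measure.volume_eq_prod]
    exact lintegral_prod (fun z : E3 × E3 => ‖α • z.1 + β • z.2‖ₑ ^ 4 * ‖u z.1 z.2‖ₑ)
      ((hqm.pow_const 4).mul hum').aemeasurable
  have hint : ∀ (x : E3) (k : ℕ), k ≤ 3 → ∫⁻ v, ‖α • x + β • v‖ₑ ^ k * ‖u x v‖ₑ ≤
      (V + 1) * ENNReal.ofReal ((a / b) ^ (4 - k)) * m x ^ ((k + 3 : ℝ) / 7) := by
    intro x k hk
    have hqx : Measurable fun v : E3 => ‖α • x + β • v‖ₑ := by fun_prop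
    have hAx : ∀ᵐ v : E3, ‖u x v‖ₑ ≤ ENNReal.ofReal (a ^ 7) := ae_of_all _ (hA x)
    have H := lintegral_pow_mul_le_interpolation hqx ha hb hAx hVt
      (fun R hR => volume_norm_add_smul_le (α • x) hb hβ hR) hk
    exact H
  have h0 : ∀ x, ∫⁻ v, ‖u x v‖ₑ ≤
      (V + 1) * ENNReal.ofReal ((a / b) ^ 4) * m x ^ (3 / 7 : ℝ) := by
    intro x
    have := hint x 0 (by norm_num)
    simpa using this
  have h3 : ∀ x, ∫⁻ v, ‖α • x + β • v‖ₑ ^ 3 * ‖u x v‖ₑ ≤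
      (V + 1) * ENNReal.ofReal (a / b) * m x ^ (6 / 7 : ℝ) := by
    intro x
    have := hint x 3 le_rfl
    norm_num at this
    exact this
  set k : E3 → ℝ≥0∞ := fun z => ‖gradient (screenedPotential κ lam) z‖ₑ with hk
  have hkm : Measurable k := (measurable_gradient_screenedPotential κ lam).enorm
  have hEm : Measurable fun x => ‖field κ lam u x‖ₑ := (field_measurable κ lam hu).enorm
  rw [hG]
  have hc1 : (V + 1) * ENNReal.ofReal ((a / b) ^ 4) ≠ ⊤ :=
    ENNReal.mul_ne_top (by simp [hVt]) ENNReal.ofReal_ne_top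
  have hc2 : (V + 1) * ENNReal.ofReal (a / b) ≠ ⊤ :=
    ENNReal.mul_ne_top (by simp [hVt]) ENNReal.ofReal_ne_top
  calc ∫⁻ z : E3 × E3, ‖α • z.1 + β • z.2‖ₑ ^ 3 * ‖field κ lam u z.1‖ₑ * ‖u z.1 z.2‖ₑ
      = ∫⁻ x, ∫⁻ v, ‖α • x + β • v‖ₑ ^ 3 * ‖field κ lam u x‖ₑ * ‖u x v‖ₑ := by
        rw [Measure.volume_eq_prod]
        exact lintegral_prod (fun z : E3 × E3 =>
          ‖α • z.1 + β • z.2‖ₑ ^ 3 * ‖field κ lam u z.1‖ₑ * ‖u z.1 z.2‖ₑ)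
          (((hqm.pow_const 3).mul (hEm.comp measurable_fst)).mul hum').aemeasurable
    _ = ∫⁻ x, ‖field κ lam u x‖ₑ * ∫⁻ v, ‖α • x + β • v‖ₑ ^ 3 * ‖u x v‖ₑ := by
        refine lintegral_congr fun x => ?_
        rw [← lintegral_const_mul' _ _ enorm_ne_top]
        refine lintegral_congr fun v => ?_
        ring
    _ ≤ ∫⁻ x, (∫⁻ y, k (x - y) * ((V + 1) * ENNReal.ofReal ((a / b) ^ 4) * m y ^ (3 / 7 : ℝ))) *
          ((V + 1) * ENNReal.ofReal (a / b) * m x ^ (6 / 7 : ℝ)) := by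
        refine lintegral_mono fun x => mul_le_mul' ?_ (h3 x)
        refine (enorm_field_le κ lam u x).trans (lintegral_mono fun y => ?_)
        exact mul_le_mul_right (h0 y) _
    _ = ((V + 1) * ENNReal.ofReal ((a / b) ^ 4)) * ((V + 1) * ENNReal.ofReal (a / b)) *
          ∫⁻ x, ∫⁻ y, k (x - y) * m y ^ (3 / 7 : ℝ) * m x ^ (6 / 7 : ℝ) := by
        rw [← lintegral_const_mul' _ _ (ENNReal.mul_ne_top hc1 hc2)]
        refine lintegral_congr fun x => ?_
        have hmx : Measurable fun y => k (x - y) * m y ^ (3 / 7 : ℝ) :=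
          (hkm.comp (measurable_const.sub measurable_id)).mul (hmm.pow_const _)
        rw [lintegral_mul_const _ hmx]
        have : ∀ y, k (x - y) * ((V + 1) * ENNReal.ofReal ((a / b) ^ 4) * m y ^ (3 / 7 : ℝ)) =
            ((V + 1) * ENNReal.ofReal ((a / b) ^ 4)) * (k (x - y) * m y ^ (3 / 7 : ℝ)) :=
          fun y => by ring
        simp_rw [this]
        rw [lintegral_const_mul _ hmx]
        ring
    _ ≤ ((V + 1) * ENNReal.ofReal ((a / b) ^ 4)) * ((V + 1) * ENNReal.ofReal (a / b)) *
          ((∫⁻ z, k z ^ (7 / 5 : ℝ)) ^ (5 / 7 : ℝ) * (∫⁻ x, m x) ^ (9 / 7 : ℝ)) := by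
        gcongr
        exact lintegral_lintegral_convolution_le hkm hmm
    _ = _ := by
        have : ENNReal.ofReal ((a / b) ^ 5) =
            ENNReal.ofReal ((a / b) ^ 4) * ENNReal.ofReal (a / b) := by
          rw [← ENNReal.ofReal_mul (by positivity), ← pow_succ]
        rw [this, interactionConst]
        ring

end Interaction


/-! ### Divergence-free affine vector fields -/

section Divergence

variable {F : Type*} [NormedAddCommGroup F] [NormedSpace ℝ F]

lemma continuous_fderiv_apply_of_contDiff {g : F → ℝ} (hg : ContDiff ℝ 1 g) {b : F → F}
    (hb : Continuous b) : Continuous fun z => fderiv ℝ g z (b z) :=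
  (hg.continuous_fderiv (by simp)).clm_apply hb

lemma hasCompactSupport_fderiv_apply {g : F → ℝ} (hc : HasCompactSupport g) (b : F → F) :
    HasCompactSupport fun z => fderiv ℝ g z (b z) := by
  refine (hc.fderiv (𝕜 := ℝ)).mono fun z hz => ?_
  rw [Function.mem_support] at hz ⊢
  contrapose! hz
  simp [hz]

variable [FiniteDimensional ℝ F] [MeasurableSpace F] [BorelSpace F] {μ : Measure F}
  [μ.IsAddHaarMeasure]

lemma integral_mul_fderiv_clm {g : F → ℝ} (hg : ContDiff ℝ 1 g) (hc : HasCompactSupport g)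
    (l : F →L[ℝ] ℝ) (c : ℝ) (e : F) :
    ∫ z, (c + l z) * fderiv ℝ g z e ∂μ = -(l e * ∫ z, g z ∂μ) := by
  have hlc : Continuous fun z => c + l z := by fun_prop
  have hd : ∀ z, fderiv ℝ (fun z => c + l z) z = l := fun z => by
    rw [fderiv_const_add]; exact l.fderiv
  have hge : Continuous fun z => fderiv ℝ g z e :=
    continuous_fderiv_apply_of_contDiff hg continuous_const
  have hce : HasCompactSupport fun z => fderiv ℝ g z e := by
    exact hasCompactSupport_fderiv_apply hc _
  rw [integral_mul_fderiv_eq_neg_fderiv_mul_of_integrable]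
  · simp_rw [hd]
    rw [integral_const_mul]
  · simp_rw [hd]
    exact (hg.continuous.integrable_of_hasCompactSupport hc).const_mul _
  · exact (hlc.mul hge).integrable_of_hasCompactSupport hce.mul_left
  · exact (hlc.mul hg.continuous).integrable_of_hasCompactSupport hc.mul_left
  · exact fun z _ => by fun_prop
  · exact fun z _ => hg.differentiable (by simp) z

/-- An affine vector field with trace-free linear part is divergence free. -/
lemma integral_fderiv_affine_eq_zero {g : F → ℝ} (hg : ContDiff ℝ 1 g) (hc : HasCompactSupport g)
    (L : F →L[ℝ] F) (hL : LinearMap.trace ℝ F L = 0) (e : F) :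
    ∫ z, fderiv ℝ g z (e + L z) ∂μ = 0 := by
  let b := Module.finBasis ℝ F
  let l : Fin (Module.finrank ℝ F) → F →L[ℝ] ℝ := fun i =>
    (LinearMap.toContinuousLinearMap (b.coord i)).comp L
  have hexp : ∀ z, fderiv ℝ g z (e + L z) =
      ∑ i, (b.coord i e + l i z) * fderiv ℝ g z (b i) := by
    intro z
    conv_lhs => rw [← b.sum_repr (e + L z), map_sum]
    refine Finset.sum_congr rfl fun i _ => ?_
    rw [map_smul, smul_eq_mul, map_add, Finsupp.add_apply]
    rfl
  have htr : ∑ i, l i (b i) = 0 := by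
    rw [← hL, LinearMap.trace_eq_matrix_trace ℝ b, Matrix.trace]
    refine Finset.sum_congr rfl fun i _ => ?_
    rw [Matrix.diag_apply, LinearMap.toMatrix_apply]
    rfl
  simp_rw [hexp]
  rw [integral_finsetSum]
  · simp_rw [integral_mul_fderiv_clm hg hc]
    rw [Finset.sum_neg_distrib, ← Finset.sum_mul, htr]
    simp
  · intro i _
    have hge : Continuous fun z => fderiv ℝ g z (b i) :=
      continuous_fderiv_apply_of_contDiff hg continuous_const
    have hce : HasCompactSupport fun z => fderiv ℝ g z (b i) := hasCompactSupport_fderiv_apply hc _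
    have hlc : Continuous fun z => b.coord i e + l i z := by fun_prop
    exact (hlc.mul hge).integrable_of_hasCompactSupport hce.mul_left

end Divergence

/-! ### Vector product and free streaming -/

section Wedge

lemma inner_wedge_self (v w : E3) : inner ℝ v (wedge v w) = 0 := by
  simp [wedge, EuclideanSpace.inner_eq_star_dotProduct, dotProduct, Fin.sum_univ_three,
    crossProduct]
  ring

/-- Antisymmetry of the triple product; it trades `v ∧ B` for `x ∧ B` in the late weight. -/
lemma inner_wedge_swap (u v w : E3) : inner ℝ u (wedge v w) = -inner ℝ v (wedge u w) := by
  simp [wedge, EuclideanSpace.inner_eq_star_dotProduct, dotProduct, Fin.sum_univ_three,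
    crossProduct]
  ring

/-- The linear map `v ↦ v ∧ w`. -/
def wedgeRight (w : E3) : E3 →L[ℝ] E3 :=
  LinearMap.toContinuousLinearMap
    { toFun := fun v => wedge v w
      map_add' := fun u v => by simp [wedge]
      map_smul' := fun c v => by simp [wedge] }

@[simp] lemma wedgeRight_apply (w v : E3) : wedgeRight w v = wedge v w := rfl

lemma trace_wedgeRight (w : E3) : LinearMap.trace ℝ E3 (wedgeRight w) = 0 := by
  rw [LinearMap.trace_eq_sum_inner _ (EuclideanSpace.basisFun (Fin 3) ℝ)]
  refine Finset.sum_eq_zero fun i _ => ?_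
  exact inner_wedge_self _ _

/-- The linear map `(x, v) ↦ (v, 0)`. -/
def freeStreaming : E3 × E3 →L[ℝ] E3 × E3 :=
  (ContinuousLinearMap.inl ℝ E3 E3).comp (ContinuousLinearMap.snd ℝ E3 E3)

@[simp] lemma freeStreaming_apply (z : E3 × E3) : freeStreaming z = (z.2, 0) := rfl

lemma trace_freeStreaming : LinearMap.trace ℝ (E3 × E3) freeStreaming = 0 := by
  have h : IsNilpotent (freeStreaming : E3 × E3 →ₗ[ℝ] E3 × E3) := by
    refine ⟨2, ?_⟩
    rw [pow_two]
    ext z <;> simp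
  exact (LinearMap.isNilpotent_trace_of_isNilpotent h).eq_zero

end Wedge

/-! ### Differentiation in time under the integral -/

section ParametricIntegral

variable {Z : Type*} [NormedAddCommGroup Z] [NormedSpace ℝ Z]
  [MeasurableSpace Z] [BorelSpace Z] {μ : Measure Z} [IsFiniteMeasureOnCompacts μ]

lemma hasDerivAt_integral_of_compactSupport {T : ℝ} {Φ : ℝ × Z → ℝ} {K : Set Z}
    (hK : IsCompact K) (hΦ : ContDiffOn ℝ 1 Φ (Ioo 0 T ×ˢ univ))
    (hsupp : ∀ t ∈ Ioo 0 T, ∀ z ∉ K, Φ (t, z) = 0) {t : ℝ} (ht : t ∈ Ioo 0 T) :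
    HasDerivAt (fun s => ∫ z, Φ (s, z) ∂μ) (∫ z, fderiv ℝ Φ (t, z) (1, 0) ∂μ) t := by
  have hopen : IsOpen (Ioo 0 T ×ˢ (univ : Set Z)) := isOpen_Ioo.prod isOpen_univ
  have hmem : ∀ {s : ℝ} (z : Z), s ∈ Ioo 0 T → (s, z) ∈ Ioo 0 T ×ˢ (univ : Set Z) :=
    fun z hs => ⟨hs, mem_univ _⟩
  have hd : ContinuousOn (fun p => fderiv ℝ Φ p (1, 0)) (Ioo 0 T ×ˢ univ) :=
    (hΦ.continuousOn_fderiv_of_isOpen hopen le_rfl).clm_apply continuousOn_const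
  have hderiv : ∀ s ∈ Ioo 0 T, ∀ z, HasDerivAt (fun r => Φ (r, z)) (fderiv ℝ Φ (s, z) (1, 0)) s := by
    intro s hs z
    have h1 : HasFDerivAt Φ (fderiv ℝ Φ (s, z)) (s, z) :=
      ((hΦ.differentiableOn (by simp)).differentiableAt (hopen.mem_nhds (hmem z hs))).hasFDerivAt
    exact h1.comp_hasDerivAt s ((hasDerivAt_id s).prodMk (hasDerivAt_const s z))
  have hslice : ∀ s ∈ Ioo 0 T, Continuous fun z => Φ (s, z) := fun s hs =>
    hΦ.continuousOn.comp_continuous (by fun_prop) fun z => hmem z hs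
  obtain ⟨δ, hδ, hball⟩ := Metric.nhds_basis_closedBall.mem_iff.1 (isOpen_Ioo.mem_nhds ht)
  obtain ⟨M, hM⟩ := ((isCompact_closedBall t δ).prod hK).exists_bound_of_continuousOn
    (hd.mono (prod_mono hball (subset_univ _)))
  refine (hasDerivAt_integral_of_dominated_loc_of_deriv_le (bound := K.indicator fun _ => M)
    (F := fun s z => Φ (s, z)) (F' := fun s z => fderiv ℝ Φ (s, z) (1, 0))
    (Metric.closedBall_mem_nhds t hδ) ?_ ?_ ?_ ?_ ?_ ?_).2
  · filter_upwards [isOpen_Ioo.mem_nhds ht] with s hs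
    exact (hslice s hs).aestronglyMeasurable
  · exact (hslice t ht).integrable_of_hasCompactSupport
      (HasCompactSupport.intro hK fun z hz => hsupp t ht z hz)
  · exact (hd.comp_continuous (by fun_prop) fun z => hmem z ht).aestronglyMeasurable
  · refine ae_of_all _ fun z s hs => ?_
    by_cases hz : z ∈ K
    · rw [indicator_of_mem hz]
      exact hM (s, z) ⟨hs, hz⟩
    · rw [indicator_of_notMem hz]
      have h0 : HasDerivAt (fun r => Φ (r, z)) 0 s := by
        refine (hasDerivAt_const s (0 : ℝ)).congr_of_eventuallyEq ?_
        filter_upwards [isOpen_Ioo.mem_nhds (hball hs)] with r hr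
        exact hsupp r hr z hz
      rw [(hderiv s (hball hs) z).unique h0, norm_zero]
  · exact (integrable_indicator_iff hK.measurableSet).2 (integrableOn_const hK.measure_lt_top.ne)
  · exact ae_of_all _ fun z s hs => hderiv s (hball hs) z

end ParametricIntegral


/-! ### Weak form of the transport equation -/

/-- `U ≥ 0` is transported by the characteristic field of the force `-(E + v ∧ B)`. -/
structure IsTransported (T : ℝ) (E B : ℝ → E3 → E3) (U : ℝ × E3 × E3 → ℝ) : Prop where
  nonneg : ∀ t ∈ Icc 0 T, ∀ z, 0 ≤ U (t, z)
  continuousOn : ContinuousOn U (Icc 0 T ×ˢ univ)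
  contDiffOn : ContDiffOn ℝ 1 U (Ioo 0 T ×ˢ univ)
  equation : ∀ t ∈ Ioo 0 T, ∀ x v,
    fderiv ℝ U (t, x, v) (1, v, -(E t x + wedge v (B t x))) = 0

section Transport

variable {T : ℝ} {E B : ℝ → E3 → E3} {U φ : ℝ × E3 × E3 → ℝ}

lemma IsTransported.continuous_slice (hU : IsTransported T E B U) {t : ℝ} (ht : t ∈ Icc 0 T) :
    Continuous fun z => U (t, z) :=
  hU.continuousOn.comp_continuous (by fun_prop) fun _ => ⟨ht, mem_univ _⟩

lemma IsTransported.differentiableAt (hU : IsTransported T E B U) {t : ℝ} (ht : t ∈ Ioo 0 T)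
    (z : E3 × E3) : DifferentiableAt ℝ U (t, z) :=
  (hU.contDiffOn.differentiableOn (by simp)).differentiableAt
    ((isOpen_Ioo.prod isOpen_univ).mem_nhds ⟨ht, mem_univ _⟩)

/-- The weak form of the transport equation, as an upper bound for the derivative of an integral
against a compactly supported weight. -/
lemma IsTransported.integral_fderiv_le (hU : IsTransported T E B U) (hφ : ContDiff ℝ 1 φ)
    {K : Set (E3 × E3)} (hK : IsCompact K) (hsupp : ∀ t ∈ Icc 0 T, ∀ z ∉ K, φ (t, z) = 0)
    {t : ℝ} (ht : t ∈ Ioo 0 T) {h : E3 × E3 → ℝ} (hm : Measurable h) (hh : ∀ z, 0 ≤ h z)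
    (hφh : ∀ᵐ x : E3, ∀ v : E3,
      fderiv ℝ φ (t, x, v) (1, v, -(E t x + wedge v (B t x))) ≤ h (x, v))
    {c : ℝ} (hc : 0 ≤ c) (hint : ∫⁻ z, ENNReal.ofReal (h z * U (t, z)) ≤ ENNReal.ofReal c) :
    ∫ z, fderiv ℝ (φ * U) (t, z) (1, 0) ≤ c := by
  have ht' : t ∈ Icc 0 T := Ioo_subset_Icc_self ht
  have hopen : IsOpen (Ioo 0 T ×ˢ (univ : Set (E3 × E3))) := isOpen_Ioo.prod isOpen_univ
  have hΦ : ContDiffOn ℝ 1 (φ * U) (Ioo 0 T ×ˢ univ) := hφ.contDiffOn.mul hU.contDiffOn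
  have hΦd : ∀ z, DifferentiableAt ℝ (φ * U) (t, z) := fun z =>
    (hφ.differentiable (by simp) _).mul (hU.differentiableAt ht z)
  set g : E3 × E3 → ℝ := fun z => (φ * U) (t, z) with hg
  have hgC : ContDiff ℝ 1 g := by
    rw [← contDiffOn_univ]
    exact hΦ.comp (contDiff_prodMk_right t).contDiffOn fun z _ => ⟨ht, mem_univ _⟩
  have hgc : HasCompactSupport g := HasCompactSupport.intro hK fun z hz => by
    simp [hg, hsupp t ht' z hz]
  have hgd : ∀ z w, fderiv ℝ g z w = fderiv ℝ (φ * U) (t, z) (0, w) := by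
    intro z w
    have h1 : HasFDerivAt g ((fderiv ℝ (φ * U) (t, z)).comp
        (ContinuousLinearMap.inr ℝ ℝ (E3 × E3))) z :=
      (hΦd z).hasFDerivAt.comp z (hasFDerivAt_prodMk_right t z)
    rw [h1.fderiv]
    rfl
  have hcont : ∀ b : E3 × E3 → ℝ × E3 × E3, Continuous b →
      Continuous fun z => fderiv ℝ (φ * U) (t, z) (b z) := by
    intro b hb
    refine Continuous.clm_apply ?_ hb
    exact (hΦ.continuousOn_fderiv_of_isOpen hopen le_rfl).comp_continuous (by fun_prop)
      fun z => ⟨ht, mem_univ _⟩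
  have hcomp : ∀ b : E3 × E3 → ℝ × E3 × E3,
      HasCompactSupport fun z => fderiv ℝ (φ * U) (t, z) (b z) := by
    intro b
    refine HasCompactSupport.intro (K := K) hK fun z hz => ?_
    have h0 : fderiv ℝ (φ * U) (t, z) = 0 := by
      have hmin : ∀ w, (t, w) ∈ Ioo 0 T ×ˢ (univ : Set (E3 × E3)) := fun w => ⟨ht, mem_univ _⟩
      have : (φ * U) =ᶠ[𝓝 (t, z)] fun _ => 0 := by
        have hn : Ioo 0 T ×ˢ Kᶜ ∈ 𝓝 (t, z) :=
          (isOpen_Ioo.prod hK.isClosed.isOpen_compl).mem_nhds ⟨ht, hz⟩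
        filter_upwards [hn] with p hp
        simp [hsupp p.1 (Ioo_subset_Icc_self hp.1) p.2 hp.2]
      rw [this.fderiv_eq, fderiv_fun_const]
      rfl
    simp [h0]
  have hint' : ∀ b : E3 × E3 → ℝ × E3 × E3, Continuous b →
      Integrable fun z => fderiv ℝ (φ * U) (t, z) (b z) := fun b hb =>
    (hcont b hb).integrable_of_hasCompactSupport (hcomp b)
  set P : E3 × E3 → ℝ := fun z => fderiv ℝ (φ * U) (t, z) (1, z.2, 0) with hP
  have hPint : Integrable P := hint' _ (by fun_prop)
  -- The `x`-transport `(v, 0)` is linear and nilpotent, hence divergence free; adding it to the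
  -- time derivative costs nothing.
  have hfree : ∫ z : E3 × E3, fderiv ℝ g z (z.2, 0) = 0 := by
    have : (volume : Measure (E3 × E3)).IsAddHaarMeasure := by
      rw [Measure.volume_eq_prod]
      infer_instance
    have := integral_fderiv_affine_eq_zero (μ := (volume : Measure (E3 × E3))) hgC hgc
      freeStreaming trace_freeStreaming 0
    simpa using this
  have hstep : ∫ z, fderiv ℝ (φ * U) (t, z) (1, 0) = ∫ z, P z := by
    have : ∀ z, fderiv ℝ (φ * U) (t, z) (1, 0) = P z - fderiv ℝ g z (z.2, 0) := by
      intro z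
      rw [hgd, hP, ← map_sub]
      simp
    simp_rw [this]
    rw [integral_sub hPint, hfree, sub_zero]
    simp_rw [hgd]
    exact hint' _ (by fun_prop)
  have hUm : Measurable fun z => U (t, z) := (hU.continuous_slice ht').measurable
  have hnn : ∀ z, 0 ≤ h z * U (t, z) := fun z => mul_nonneg (hh z) (hU.nonneg t ht' z)
  have hHint : Integrable fun z => h z * U (t, z) := by
    refine ⟨(hm.mul hUm).aestronglyMeasurable, ?_⟩
    rw [hasFiniteIntegral_iff_ofReal (ae_of_all _ hnn)]
    exact hint.trans_lt ENNReal.ofReal_lt_top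
  -- The force is treated slice by slice in `x`: for fixed `x` it is affine in `v` with trace-free
  -- linear part. No regularity of `E` or `B` in `x` is needed, and a bound for almost every `x`
  -- suffices.
  have hle : ∫ z, P z ≤ ∫ z, h z * U (t, z) := by
    have hP2 := hPint
    have hH2 := hHint
    rw [Measure.volume_eq_prod] at hP2 hH2 ⊢
    rw [integral_prod _ hP2, integral_prod _ hH2]
    refine integral_mono_ae hP2.integral_prod_left hH2.integral_prod_left ?_
    filter_upwards [hφh, hH2.prod_right_ae, hP2.prod_right_ae] with x hx hHx hPx
    set b : E3 → E3 := fun v => E t x + wedge v (B t x) with hb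
    have hgx : ContDiff ℝ 1 fun v => g (x, v) := hgC.comp (contDiff_prodMk_right x)
    have hgxc : HasCompactSupport fun v => g (x, v) :=
      HasCompactSupport.intro (hK.image continuous_snd) fun v hv => by
        have : (x, v) ∉ K := fun h => hv ⟨(x, v), h, rfl⟩
        simp [hg, hsupp t ht' _ this]
    have hgxd : ∀ v w, fderiv ℝ (fun v => g (x, v)) v w =
        fderiv ℝ (φ * U) (t, x, v) (0, 0, w) := by
      intro v w
      have h1 : HasFDerivAt (fun v => g (x, v)) ((fderiv ℝ g (x, v)).comp
          (ContinuousLinearMap.inr ℝ E3 E3)) v :=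
        (hgC.differentiable (by simp) (x, v)).hasFDerivAt.comp v (hasFDerivAt_prodMk_right x v)
      rw [h1.fderiv]
      exact hgd (x, v) (0, w)
    have hbL : ∀ v, b v = E t x + wedgeRight (B t x) v := fun v => rfl
    have hzero : ∫ v, fderiv ℝ (fun v => g (x, v)) v (b v) = 0 :=
      integral_fderiv_affine_eq_zero hgx hgxc _ (trace_wedgeRight _) _
    have hbc : Continuous b := by
      simp_rw [funext hbL]
      fun_prop
    have hbint : Integrable fun v => fderiv ℝ (fun v => g (x, v)) v (b v) :=
      (continuous_fderiv_apply_of_contDiff hgx hbc).integrable_of_hasCompactSupport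
        (hasCompactSupport_fderiv_apply hgxc b)
    calc ∫ v, P (x, v) = ∫ v, (P (x, v) - fderiv ℝ (fun v => g (x, v)) v (b v)) := by
          rw [integral_sub hPx hbint, hzero, sub_zero]
      _ ≤ ∫ v, h (x, v) * U (t, x, v) := by
          refine integral_mono (hPx.sub hbint) hHx fun v => ?_
          have e1 : P (x, v) - fderiv ℝ (fun v => g (x, v)) v (b v) =
              fderiv ℝ (φ * U) (t, x, v) (1, v, -b v) := by
            rw [hgxd, hP, ← map_sub]
            simp
          have e2 : fderiv ℝ (φ * U) (t, x, v) (1, v, -b v) =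
              U (t, x, v) * fderiv ℝ φ (t, x, v) (1, v, -b v) := by
            rw [fderiv_mul (hφ.differentiable (by simp) _) (hU.differentiableAt ht _)]
            have := hU.equation t ht x v
            simp only [add_apply, smul_apply, hb, this,
              smul_eq_mul, mul_zero, zero_add]
          simp only [e1, e2]
          rw [mul_comm]
          exact mul_le_mul_of_nonneg_right (hx v) (hU.nonneg t ht' _)
  calc _ = ∫ z, P z := hstep
    _ ≤ ∫ z, h z * U (t, z) := hle
    _ ≤ c := by
        rw [integral_eq_lintegral_of_nonneg_ae (ae_of_all _ hnn) hHint.aestronglyMeasurable]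
        exact ENNReal.toReal_le_of_le_ofReal hc hint

end Transport

/-! ### Cutoffs adapted to a bounded field -/

section Cutoff

/-- The confining weight `1 + |x|² + |v|²`. -/
def phaseWeight (z : E3 × E3) : ℝ := 1 + ‖z.1‖ ^ 2 + ‖z.2‖ ^ 2

lemma contDiff_phaseWeight : ContDiff ℝ 1 phaseWeight := by
  unfold phaseWeight
  exact (contDiff_const.add (contDiff_fst.norm_sq ℝ)).add (contDiff_snd.norm_sq ℝ)

lemma one_le_phaseWeight (z : E3 × E3) : 1 ≤ phaseWeight z := by
  unfold phaseWeight
  nlinarith [sq_nonneg ‖z.1‖, sq_nonneg ‖z.2‖]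

lemma fderiv_apply_of_hasDerivAt {F : Type*} [NormedAddCommGroup F] [NormedSpace ℝ F] {f : F → ℝ}
    {p w : F} (hf : DifferentiableAt ℝ f p) {d : ℝ}
    (h : HasDerivAt (fun s : ℝ => f (p + s • w)) d 0) : fderiv ℝ f p w = d := by
  rw [← hf.lineDeriv_eq_fderiv]
  exact HasLineDerivAt.lineDeriv h

lemma hasDerivAt_add_smul {F : Type*} [NormedAddCommGroup F] [NormedSpace ℝ F] (x v : F) :
    HasDerivAt (fun s : ℝ => x + s • v) v 0 := by
  simpa using ((hasDerivAt_id (0 : ℝ)).smul_const v).const_add x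

lemma hasDerivAt_norm_sq_add_smul (x v : E3) :
    HasDerivAt (fun s : ℝ => ‖x + s • v‖ ^ 2) (2 * inner ℝ x v) 0 := by
  simpa using (hasDerivAt_add_smul x v).norm_sq

lemma hasDerivAt_phaseWeight (z w : E3 × E3) :
    HasDerivAt (fun s : ℝ => phaseWeight (z + s • w))
      (2 * inner ℝ z.1 w.1 + 2 * inner ℝ z.2 w.2) 0 := by
  have := ((hasDerivAt_norm_sq_add_smul z.1 w.1).const_add 1).add
    (hasDerivAt_norm_sq_add_smul z.2 w.2)
  exact this

lemma hasDerivAt_exp_mul_phaseWeight (ν t : ℝ) (z w : E3 × E3) :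
    HasDerivAt (fun s : ℝ => Real.exp (ν * (t + s)) * phaseWeight (z + s • w))
      (Real.exp (ν * t) *
        (ν * phaseWeight z + (2 * inner ℝ z.1 w.1 + 2 * inner ℝ z.2 w.2))) 0 := by
  have h1 : HasDerivAt (fun s : ℝ => Real.exp (ν * (t + s))) (Real.exp (ν * t) * ν) 0 := by
    have := (((hasDerivAt_id (0 : ℝ)).const_add t).const_mul ν).exp
    simpa using this
  have h2 := h1.mul (hasDerivAt_phaseWeight z w)
  refine h2.congr_deriv ?_
  simp only [add_zero, zero_smul]
  ring

/-- Along the characteristics, `phaseWeight` grows at most exponentially. -/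
lemma abs_phaseWeight_derivative_le {x v e b : E3} {C : ℝ} (he : ‖e‖ ≤ C) :
    |2 * inner ℝ x v + 2 * inner ℝ v (-(e + wedge v b))| ≤
      (2 + C ^ 2) * phaseWeight (x, v) := by
  have h0 : inner ℝ v (-(e + wedge v b)) = -inner ℝ v e := by
    rw [inner_neg_right, inner_add_right, inner_wedge_self, add_zero]
  rw [h0]
  have h1 := abs_le.1 (abs_real_inner_le_norm x v)
  have h2 := abs_le.1 (abs_real_inner_le_norm v e)
  have h3 : ‖v‖ * ‖e‖ ≤ ‖v‖ * C := by gcongr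
  have h4 : 2 * (‖v‖ * C) ≤ ‖v‖ ^ 2 + C ^ 2 := by nlinarith [sq_nonneg (‖v‖ - C)]
  have h5 : 2 * (‖x‖ * ‖v‖) ≤ ‖x‖ ^ 2 + ‖v‖ ^ 2 := by nlinarith [sq_nonneg (‖x‖ - ‖v‖)]
  have h6 : 0 ≤ C ^ 2 * (‖x‖ ^ 2 + ‖v‖ ^ 2) := by positivity
  have h7 : 0 ≤ ‖x‖ ^ 2 := by positivity
  simp only [phaseWeight]
  rw [abs_le]
  constructor <;> nlinarith

/-- A cutoff in phase space whose support shrinks fast enough in time for the cutoff to be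
nonincreasing along characteristics. -/
def cutoff (ν R : ℝ) (p : ℝ × E3 × E3) : ℝ :=
  Real.smoothTransition (2 - R⁻¹ * (Real.exp (ν * p.1) * phaseWeight p.2))

variable {ν R : ℝ}

lemma contDiff_cutoff : ContDiff ℝ 1 (cutoff ν R) := by
  refine (Real.smoothTransition.contDiff (n := 1)).comp ?_
  refine contDiff_const.sub (contDiff_const.mul (ContDiff.mul ?_ ?_))
  · exact (contDiff_const.mul contDiff_fst).exp
  · exact contDiff_phaseWeight.comp contDiff_snd

lemma cutoff_nonneg (p : ℝ × E3 × E3) : 0 ≤ cutoff ν R p := Real.smoothTransition.nonneg _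

lemma cutoff_le_one (p : ℝ × E3 × E3) : cutoff ν R p ≤ 1 := Real.smoothTransition.le_one _

lemma cutoff_eq_zero (hν : 0 ≤ ν) (hR : 0 < R) {t : ℝ} (ht : 0 ≤ t) {z : E3 × E3}
    (hz : 2 * R ≤ phaseWeight z) : cutoff ν R (t, z) = 0 := by
  refine Real.smoothTransition.zero_of_nonpos ?_
  have h1 : 1 ≤ Real.exp (ν * t) := Real.one_le_exp (mul_nonneg hν ht)
  have h2 : 2 * R ≤ Real.exp (ν * t) * phaseWeight z :=
    hz.trans (le_mul_of_one_le_left (zero_le_one.trans (one_le_phaseWeight z)) h1)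
  have h3 : 2 ≤ R⁻¹ * (Real.exp (ν * t) * phaseWeight z) := by
    rw [← div_eq_inv_mul, le_div_iff₀ hR]
    exact h2
  simpa using h3

lemma cutoff_eq_one (hR : 0 < R) {t : ℝ} {z : E3 × E3}
    (hz : Real.exp (ν * t) * phaseWeight z ≤ R) : cutoff ν R (t, z) = 1 := by
  refine Real.smoothTransition.one_of_one_le ?_
  have h3 : R⁻¹ * (Real.exp (ν * t) * phaseWeight z) ≤ 1 := by
    rw [← div_eq_inv_mul, div_le_one hR]
    exact hz
  simp only
  linarith

/-- The rate `ν ≥ 2 + C^2` dominates any decrease of `phaseWeight` along characteristics, so `e^(ν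
t) * phaseWeight` is nondecreasing there and the monotone step function of its negative decreases.
The magnetic term contributes nothing since `v · (v ∧ b) = 0`. -/
lemma fderiv_cutoff_nonpos (hR : 0 < R) {C : ℝ} (hν : 2 + C ^ 2 ≤ ν) (t : ℝ) {x v e b : E3}
    (he : ‖e‖ ≤ C) :
    fderiv ℝ (cutoff ν R) (t, x, v) (1, v, -(e + wedge v b)) ≤ 0 := by
  have h1 := hasDerivAt_exp_mul_phaseWeight ν t (x, v) (v, -(e + wedge v b))
  have h2 := (h1.const_mul R⁻¹).const_sub 2
  have h3 : HasDerivAt Real.smoothTransition (deriv Real.smoothTransition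
      (2 - R⁻¹ * (Real.exp (ν * (t + 0)) * phaseWeight ((x, v) + (0 : ℝ) • (v, -(e + wedge v b))))))
      (2 - R⁻¹ * (Real.exp (ν * (t + 0)) * phaseWeight ((x, v) + (0 : ℝ) • (v, -(e + wedge v b))))) :=
    ((Real.smoothTransition.contDiff (n := 1)).differentiable (by simp) _).hasDerivAt
  have h4 := h3.comp (0 : ℝ) h2
  rw [fderiv_apply_of_hasDerivAt (d := _) (contDiff_cutoff.differentiable (by simp) _)
    (h4.congr_of_eventuallyEq (Eventually.of_forall fun s => ?_))]
  · refine mul_nonpos_of_nonneg_of_nonpos Real.smoothTransition.monotone.deriv_nonneg ?_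
    have h5 := (abs_le.1 (abs_phaseWeight_derivative_le (x := x) (v := v) (b := b) he)).1
    have h6 := one_le_phaseWeight (x, v)
    have h7 : 0 ≤ ν * phaseWeight (x, v) +
        (2 * inner ℝ x v + 2 * inner ℝ v (-(e + wedge v b))) := by nlinarith
    have : 0 ≤ R⁻¹ * (Real.exp (ν * t) * (ν * phaseWeight (x, v) +
        (2 * inner ℝ x v + 2 * inner ℝ v (-(e + wedge v b))))) := by positivity
    simpa using this
  · simp [cutoff]

lemma isCompact_phaseWeight_le (R : ℝ) : IsCompact {z : E3 × E3 | phaseWeight z ≤ R} := by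
  refine (isCompact_closedBall (0 : E3 × E3) R).of_isClosed_subset
    (isClosed_le contDiff_phaseWeight.continuous continuous_const) fun z hz => ?_
  have hz : 1 + ‖z.1‖ ^ 2 + ‖z.2‖ ^ 2 ≤ R := hz
  rw [mem_closedBall_zero_iff, Prod.norm_def]
  refine max_le ?_ ?_ <;> nlinarith [sq_nonneg (‖z.1‖ - 1), sq_nonneg (‖z.2‖ - 1),
    sq_nonneg ‖z.1‖, sq_nonneg ‖z.2‖]

end Cutoff

/-- Growth of weighted integrals of a transported density. -/
lemma IsTransported.lintegral_le {T : ℝ} {E B : ℝ → E3 → E3} {U : ℝ × E3 × E3 → ℝ}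
    (hU : IsTransported T E B U) {C : ℝ} (hE : ∀ t ∈ Icc 0 T, ∀ x, ‖E t x‖ ≤ C)
    {p : ℝ × E3 × E3 → ℝ} (hp : ContDiff ℝ 1 p) (hp0 : ∀ q, 0 ≤ p q)
    {h : ℝ → E3 × E3 → ℝ} {G G' : ℝ → ℝ} {s t : ℝ} (hs : 0 ≤ s) (hst : s ≤ t) (htT : t ≤ T)
    (hm : ∀ τ ∈ Ioo s t, Measurable (h τ)) (hh : ∀ τ ∈ Ioo s t, ∀ z, 0 ≤ h τ z)
    (hph : ∀ τ ∈ Ioo s t, ∀ᵐ x : E3, ∀ v : E3,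
      fderiv ℝ p (τ, x, v) (1, v, -(E τ x + wedge v (B τ x))) ≤ h τ (x, v))
    (hG : ContinuousOn G (Icc s t)) (hG' : ∀ τ ∈ Ioo s t, HasDerivAt G (G' τ) τ)
    (hG0 : ∀ τ ∈ Ioo s t, 0 ≤ G' τ)
    (hint : ∀ τ ∈ Ioo s t,
      ∫⁻ z, ENNReal.ofReal (h τ z * U (τ, z)) ≤ ENNReal.ofReal (G' τ)) :
    ∫⁻ z, ENNReal.ofReal (p (t, z) * U (t, z)) ≤
      (∫⁻ z, ENNReal.ofReal (p (s, z) * U (s, z))) + ENNReal.ofReal (G t - G s) := by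
  have hsI : s ∈ Icc s t := left_mem_Icc.2 hst
  have htI : t ∈ Icc s t := right_mem_Icc.2 hst
  have hsub : Icc s t ⊆ Icc 0 T := Icc_subset_Icc hs htT
  have hsub' : Ioo s t ⊆ Ioo 0 T := Ioo_subset_Ioo hs htT
  set ν := 2 + C ^ 2 with hν
  have hν0 : 0 ≤ ν := by positivity
  have hbound : ∀ n : ℕ, ∫⁻ z, ENNReal.ofReal (p (t, z) * cutoff ν (n + 1) (t, z) * U (t, z)) ≤
      (∫⁻ z, ENNReal.ofReal (p (s, z) * U (s, z))) + ENNReal.ofReal (G t - G s) := by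
    intro n
    set R : ℝ := n + 1 with hRn
    have hR : 0 < R := by positivity
    set φ : ℝ × E3 × E3 → ℝ := p * cutoff ν R with hφ
    have hφC : ContDiff ℝ 1 φ := hp.mul contDiff_cutoff
    have hφ0 : ∀ q, 0 ≤ φ q := fun q => mul_nonneg (hp0 q) (cutoff_nonneg q)
    have hK := isCompact_phaseWeight_le (2 * R)
    have hsupp : ∀ τ ∈ Icc 0 T, ∀ z ∉ {z : E3 × E3 | phaseWeight z ≤ 2 * R}, φ (τ, z) = 0 := by
      intro τ hτ z hz
      have hz : 2 * R < phaseWeight z := not_le.1 hz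
      simp [hφ, cutoff_eq_zero hν0 hR hτ.1 hz.le]
    set F : ℝ → ℝ := fun τ => ∫ z, (φ * U) (τ, z) with hF
    have hFc : ContinuousOn F (Icc s t) := by
      refine ContinuousOn.mono ?_ hsub
      refine continuousOn_integral_of_compact_support (f := fun τ z => (φ * U) (τ, z)) hK ?_ ?_
      · exact hφC.continuous.continuousOn.mul hU.continuousOn
      · intro τ z hτ hz
        simp [hsupp τ hτ z hz]
    have hFd : ∀ τ ∈ Ioo s t, HasDerivAt F (∫ z, fderiv ℝ (φ * U) (τ, z) (1, 0)) τ := by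
      intro τ hτ
      refine hasDerivAt_integral_of_compactSupport hK (hφC.contDiffOn.mul hU.contDiffOn) ?_
        (hsub' hτ)
      intro r hr z hz
      simp [hsupp r (Ioo_subset_Icc_self hr) z hz]
    have hFle : ∀ τ ∈ Ioo s t, ∫ z, fderiv ℝ (φ * U) (τ, z) (1, 0) ≤ G' τ := by
      intro τ hτ
      refine hU.integral_fderiv_le hφC hK hsupp (hsub' hτ) (hm τ hτ) (hh τ hτ) ?_ (hG0 τ hτ)
        (hint τ hτ)
      filter_upwards [hph τ hτ] with x hx v
      rw [hφ, fderiv_mul (hp.differentiable (by simp) _)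
        (contDiff_cutoff.differentiable (by simp) _)]
      simp only [add_apply, smul_apply, smul_eq_mul]
      have h1 := fderiv_cutoff_nonpos (R := R) hR hν.ge τ (x := x) (v := v) (b := B τ x)
        (hE τ (Ioo_subset_Icc_self (hsub' hτ)) x)
      have h2 : p (τ, x, v) * fderiv ℝ (cutoff ν R) (τ, x, v)
          (1, v, -(E τ x + wedge v (B τ x))) ≤ 0 := mul_nonpos_of_nonneg_of_nonpos (hp0 _) h1
      -- Dropping the cutoff in front of `h` uses `0 ≤ h`; this is why the majorant has to be
      -- nonnegative.
      have h3 : cutoff ν R (τ, x, v) * fderiv ℝ p (τ, x, v)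
          (1, v, -(E τ x + wedge v (B τ x))) ≤ 1 * h τ (x, v) :=
        (mul_le_mul_of_nonneg_left (hx v) (cutoff_nonneg _)).trans
          (mul_le_mul_of_nonneg_right (cutoff_le_one _) (hh τ hτ _))
      linarith
    have hanti : AntitoneOn (F - G) (Icc s t) := by
      refine antitoneOn_of_deriv_nonpos (convex_Icc s t) (hFc.sub hG) ?_ ?_
      · rw [interior_Icc]
        exact fun τ hτ => ((hFd τ hτ).sub (hG' τ hτ)).differentiableAt.differentiableWithinAt
      · rw [interior_Icc]
        intro τ hτ
        rw [((hFd τ hτ).sub (hG' τ hτ)).deriv]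
        linarith [hFle τ hτ]
    have hmain : F t ≤ F s + (G t - G s) := by
      have : F t - G t ≤ F s - G s := hanti hsI htI hst
      linarith
    have hFof : ∀ τ ∈ Icc s t, ENNReal.ofReal (F τ) = ∫⁻ z, ENNReal.ofReal ((φ * U) (τ, z)) := by
      intro τ hτ
      refine ofReal_integral_eq_lintegral_ofReal ?_ (ae_of_all _ fun z =>
        mul_nonneg (hφ0 _) (hU.nonneg τ (hsub hτ) z))
      refine Continuous.integrable_of_hasCompactSupport ?_ (HasCompactSupport.intro hK fun z hz => ?_)
      · exact (hφC.continuous.comp (by fun_prop)).mul (hU.continuous_slice (hsub hτ))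
      · simp [hsupp τ (hsub hτ) z hz]
    calc _ = ENNReal.ofReal (F t) := (hFof t htI).symm
      _ ≤ ENNReal.ofReal (F s + (G t - G s)) := ENNReal.ofReal_le_ofReal hmain
      _ ≤ ENNReal.ofReal (F s) + ENNReal.ofReal (G t - G s) := ENNReal.ofReal_add_le
      _ ≤ _ := by
        rw [hFof s hsI]
        gcongr with z
        exact mul_le_mul_of_nonneg_right (mul_le_of_le_one_right (hp0 _) (cutoff_le_one _))
          (hU.nonneg s (hsub hsI) z)
  have hpt : ∀ z, Tendsto (fun n : ℕ =>
      ENNReal.ofReal (p (t, z) * cutoff ν (n + 1) (t, z) * U (t, z))) atTop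
      (𝓝 (ENNReal.ofReal (p (t, z) * U (t, z)))) := by
    intro z
    refine tendsto_const_nhds.congr' ?_
    obtain ⟨N, hN⟩ := exists_nat_ge (Real.exp (ν * t) * phaseWeight z)
    filter_upwards [eventually_ge_atTop N] with n hn
    have hNn : (N : ℝ) ≤ n := by exact_mod_cast hn
    rw [cutoff_eq_one (by positivity) (by linarith), mul_one]
  -- Fatou removes the cutoff at the final time; at the initial time it was already bounded by one.
  calc _ = ∫⁻ z, liminf (fun n : ℕ =>
        ENNReal.ofReal (p (t, z) * cutoff ν (n + 1) (t, z) * U (t, z))) atTop :=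
        lintegral_congr fun z => (hpt z).liminf_eq.symm
    _ ≤ liminf (fun n : ℕ =>
        ∫⁻ z, ENNReal.ofReal (p (t, z) * cutoff ν (n + 1) (t, z) * U (t, z))) atTop := by
        refine lintegral_liminf_le fun n => ENNReal.measurable_ofReal.comp ?_
        have h1 : Continuous fun z : E3 × E3 => p (t, z) := hp.continuous.comp (by fun_prop)
        have h2 : Continuous fun z : E3 × E3 => cutoff ν (n + 1) (t, z) :=
          (contDiff_cutoff (ν := ν) (R := n + 1)).continuous.comp (by fun_prop)
        exact ((h1.mul h2).mul (hU.continuous_slice (hsub htI))).measurable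
    _ ≤ _ := liminf_le_of_le (by isBoundedDefault) fun b hb => by
        obtain ⟨n, hn⟩ := hb.exists
        exact hn.trans (hbound n)


/-! ### Mass, maximum principle and preliminary moment bounds -/

section Consequences

variable {T C : ℝ} {E B : ℝ → E3 → E3} {U : ℝ × E3 × E3 → ℝ}

lemma IsTransported.lintegral_mass_le (hU : IsTransported T E B U)
    (hE : ∀ t ∈ Icc 0 T, ∀ x, ‖E t x‖ ≤ C) {t : ℝ} (ht : t ∈ Icc 0 T) :
    ∫⁻ z, ENNReal.ofReal (U (t, z)) ≤ ∫⁻ z, ENNReal.ofReal (U (0, z)) := by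
  have := hU.lintegral_le hE (p := fun _ => 1) contDiff_const (fun _ => zero_le_one)
    (h := fun _ _ => 0) (G := fun _ => 0) (G' := fun _ => 0) le_rfl ht.1 ht.2
    (fun _ _ => measurable_const) (fun _ _ _ => le_rfl) (fun τ _ => ae_of_all _ fun x v => by simp)
    continuousOn_const (fun τ _ => hasDerivAt_const τ 0) (fun _ _ => le_rfl) (fun _ _ => by simp)
  simpa using this

lemma IsTransported.comp (hU : IsTransported T E B U) {η : ℝ → ℝ} (hη : ContDiff ℝ 1 η)
    (hη0 : ∀ r, 0 ≤ η r) : IsTransported T E B (η ∘ U) where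
  nonneg _ _ _ := hη0 _
  continuousOn := hη.continuous.comp_continuousOn hU.continuousOn
  contDiffOn := hη.comp_contDiffOn hU.contDiffOn
  equation t ht x v := by
    rw [fderiv_comp _ (hη.differentiable (by simp) _) (hU.differentiableAt ht _)]
    simp [hU.equation t ht x v, -neg_add_rev]

/-- A smooth nonnegative function vanishing exactly on `(-∞, 0]`, evaluated at `U - A`, is again
transported. Its mass is zero initially, hence always, and continuity turns "almost everywhere" into
"everywhere". -/
lemma IsTransported.le_of_initial_le (hU : IsTransported T E B U)
    (hE : ∀ t ∈ Icc 0 T, ∀ x, ‖E t x‖ ≤ C) {A : ℝ} (hA : ∀ z, U (0, z) ≤ A) {t : ℝ}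
    (ht : t ∈ Icc 0 T) (z : E3 × E3) : U (t, z) ≤ A := by
  have hη : ContDiff ℝ 1 fun r => expNegInvGlue (r - A) :=
    (expNegInvGlue.contDiff (n := 1)).comp (contDiff_id.sub contDiff_const)
  have hV := hU.comp hη fun r => expNegInvGlue.nonneg _
  have h := hV.lintegral_mass_le hE ht
  have h0 : ∀ z, expNegInvGlue (U (0, z) - A) = 0 := fun z =>
    expNegInvGlue.zero_of_nonpos (sub_nonpos.2 (hA z))
  simp only [Function.comp_apply, h0, ENNReal.ofReal_zero, lintegral_zero, nonpos_iff_eq_zero] at h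
  have hc : Continuous fun z => expNegInvGlue (U (t, z) - A) := hV.continuous_slice ht
  rw [lintegral_eq_zero_iff hc.measurable.ennreal_ofReal] at h
  have hae : (fun z => expNegInvGlue (U (t, z) - A)) =ᵐ[volume] fun _ => 0 := by
    filter_upwards [h] with z hz
    exact le_antisymm (ENNReal.ofReal_eq_zero.1 hz) (expNegInvGlue.nonneg _)
  have : Measure.IsOpenPosMeasure (volume : Measure (E3 × E3)) := by
    rw [Measure.volume_eq_prod]
    infer_instance
  have heq := congrFun ((hc.ae_eq_iff_eq volume continuous_const).1 hae) z
  exact sub_nonpos.1 (expNegInvGlue.zero_iff_nonpos.1 heq)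

/-- `e^(-ν t) * phaseWeight` does not increase along characteristics for `ν = 2 + C^2`; squaring it
reaches fourth moments. The bound depends on the solution through `C` and serves only to know that
moments are finite. -/
lemma IsTransported.exists_phaseWeight_bound (hU : IsTransported T E B U)
    (hE : ∀ t ∈ Icc 0 T, ∀ x, ‖E t x‖ ≤ C)
    (h0 : ∫⁻ z, ENNReal.ofReal (phaseWeight z ^ 2 * U (0, z)) ≠ ⊤) :
    ∃ K : ℝ, 0 ≤ K ∧ ∀ t ∈ Icc 0 T,
      ∫⁻ z, ENNReal.ofReal (phaseWeight z ^ 2 * U (t, z)) ≤ ENNReal.ofReal K := by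
  set ν := 2 + C ^ 2 with hν
  let p : ℝ × E3 × E3 → ℝ := fun q => (Real.exp (-ν * q.1) * phaseWeight q.2) ^ 2
  have hp1 : ContDiff ℝ 1 fun q : ℝ × E3 × E3 => Real.exp (-ν * q.1) * phaseWeight q.2 :=
    (contDiff_const.mul contDiff_fst).exp.mul (contDiff_phaseWeight.comp contDiff_snd)
  have hp : ContDiff ℝ 1 p := hp1.pow 2
  set I₀ := ∫⁻ z, ENNReal.ofReal (phaseWeight z ^ 2 * U (0, z)) with hI₀
  refine ⟨(ENNReal.ofReal (Real.exp (2 * ν * T)) * I₀).toReal, ENNReal.toReal_nonneg, fun t ht => ?_⟩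
  rw [ENNReal.ofReal_toReal (ENNReal.mul_ne_top ENNReal.ofReal_ne_top h0)]
  have key := hU.lintegral_le hE (p := p) hp (fun _ => sq_nonneg _)
    (h := fun _ _ => 0) (G := fun _ => 0) (G' := fun _ => 0) le_rfl ht.1 ht.2
    (fun _ _ => measurable_const) (fun _ _ _ => le_rfl) (fun τ hτ => ae_of_all _ fun x v => ?_)
    continuousOn_const (fun τ _ => hasDerivAt_const τ 0) (fun _ _ => le_rfl) (fun _ _ => by simp)
  · simp only [sub_zero, ENNReal.ofReal_zero, add_zero] at key
    have e0 : ∀ z, p (0, z) = phaseWeight z ^ 2 := fun z => by simp [p]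
    simp only [e0] at key
    calc _ ≤ ∫⁻ z, ENNReal.ofReal (Real.exp (2 * ν * T)) * ENNReal.ofReal (p (t, z) * U (t, z)) := by
          refine lintegral_mono fun z => ?_
          rw [← ENNReal.ofReal_mul (Real.exp_pos _).le]
          refine ENNReal.ofReal_le_ofReal ?_
          rw [← mul_assoc]
          refine mul_le_mul_of_nonneg_right ?_ (hU.nonneg t ht z)
          have e1 : Real.exp (2 * ν * T) * p (t, z) =
              Real.exp (2 * ν * (T - t)) * phaseWeight z ^ 2 := by
            simp only [p]
            rw [mul_pow, ← mul_assoc, ← Real.exp_nat_mul, ← Real.exp_add]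
            congr 2
            push_cast
            ring
          rw [e1]
          refine le_mul_of_one_le_left (sq_nonneg _) (Real.one_le_exp ?_)
          have : 0 ≤ T - t := sub_nonneg.2 ht.2
          positivity
      _ = ENNReal.ofReal (Real.exp (2 * ν * T)) * ∫⁻ z, ENNReal.ofReal (p (t, z) * U (t, z)) :=
          lintegral_const_mul' _ _ ENNReal.ofReal_ne_top
      _ ≤ _ := by gcongr
  · have h1 := (hasDerivAt_exp_mul_phaseWeight (-ν) τ (x, v)
      (v, -(E τ x + wedge v (B τ x)))).pow 2
    rw [fderiv_apply_of_hasDerivAt (hp.differentiable (by simp) _)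
      (h1.congr_of_eventuallyEq (Eventually.of_forall fun s => by simp [p]))]
    have h2 := (abs_le.1 (abs_phaseWeight_derivative_le (x := x) (v := v) (b := B τ x)
      (hE τ (Ioo_subset_Icc_self (Ioo_subset_Ioo le_rfl ht.2 hτ)) x))).2
    have h3 := one_le_phaseWeight (x, v)
    simp only [add_zero, zero_smul, Nat.reduceSub, pow_one]
    refine mul_nonpos_of_nonneg_of_nonpos (by positivity)
      (mul_nonpos_of_nonneg_of_nonpos (by positivity) ?_)
    linarith

end Consequences

/-! ### Classical solutions as transported densities -/

section Solutions

variable {κ lam T : ℝ} {B : ℝ → E3 → E3} {fin : E3 → E3 → ℝ} {f : ℝ → E3 → E3 → ℝ}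

lemma IsClassicalSolution.isTransported (hf : IsClassicalSolution κ lam T B fin f) :
    IsTransported T (fun t => field κ lam (f t)) B (fun p => f p.1 p.2.1 p.2.2) where
  nonneg t ht z := hf.nonneg t ht z.1 z.2
  continuousOn := hf.continuousOn
  contDiffOn := hf.contDiffOn
  equation t ht x v := by
    set U : ℝ × E3 × E3 → ℝ := fun p => f p.1 p.2.1 p.2.2 with hU
    have hd : HasFDerivAt U (fderiv ℝ U (t, x, v)) (t, x, v) :=
      ((hf.contDiffOn.differentiableOn (by simp)).differentiableAt
        ((isOpen_Ioo.prod isOpen_univ).mem_nhds ⟨ht, mem_univ _⟩)).hasFDerivAt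
    have h1 : deriv (fun s => f s x v) t = fderiv ℝ U (t, x, v) (1, 0, 0) := by
      have h : HasDerivAt (fun s : ℝ => (s, x, v)) (1, 0, 0) t :=
        (hasDerivAt_id t).prodMk (hasDerivAt_const t (x, v))
      exact (HasFDerivAt.comp_hasDerivAt (f := fun s : ℝ => (s, x, v)) t hd h).deriv
    have h2 : ∀ w, inner ℝ w (gradient (fun y => f t y v) x) = fderiv ℝ U (t, x, v) (0, w, 0) := by
      intro w
      have h : HasFDerivAt (fun y : E3 => (t, y, v))
          ((0 : E3 →L[ℝ] ℝ).prod ((ContinuousLinearMap.id ℝ E3).prod 0)) x :=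
        (hasFDerivAt_const t x).prodMk ((hasFDerivAt_id x).prodMk (hasFDerivAt_const v x))
      have h' := HasFDerivAt.comp (f := fun y : E3 => (t, y, v)) x hd h
      rw [real_inner_comm, gradient, InnerProductSpace.toDual_symm_apply,
        show (fun y => f t y v) = U ∘ fun y => (t, y, v) from rfl, h'.fderiv]
      rfl
    have h3 : ∀ w, inner ℝ w (gradient (fun y => f t x y) v) = fderiv ℝ U (t, x, v) (0, 0, w) := by
      intro w
      have h : HasFDerivAt (fun y : E3 => (t, x, y))
          ((0 : E3 →L[ℝ] ℝ).prod ((0 : E3 →L[ℝ] E3).prod (ContinuousLinearMap.id ℝ E3))) v :=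
        (hasFDerivAt_const t v).prodMk ((hasFDerivAt_const x v).prodMk (hasFDerivAt_id v))
      have h' := HasFDerivAt.comp (f := fun y : E3 => (t, x, y)) v hd h
      rw [real_inner_comm, gradient, InnerProductSpace.toDual_symm_apply,
        show (fun y => f t x y) = U ∘ fun y => (t, x, y) from rfl, h'.fderiv]
      rfl
    have heq := hf.equation t ht x v
    rw [h1, h2, h3, ← map_add, ← map_sub] at heq
    simpa using heq

end Solutions

/-- A continuity argument for a function whose increments are controlled as long as it stays below
a threshold. -/
lemma le_of_increment_le {m : ℝ → ℝ≥0∞} {s₀ t₀ : ℝ} {g : ℝ → ℝ} (hg : ContinuousOn g (Icc s₀ t₀))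
    (hmono : MonotoneOn g (Icc s₀ t₀)) {c k D : ℝ} (hc : 0 ≤ c)
    (hD : ∀ s ∈ Icc s₀ t₀, ∀ t ∈ Icc s₀ t₀, s ≤ t → (∀ τ ∈ Ioo s t, m τ ≤ ENNReal.ofReal D) →
      m t ≤ m s + ENNReal.ofReal (c * (g t - g s)))
    (hk : ∀ s ∈ Icc s₀ t₀, ∀ t ∈ Icc s₀ t₀, s ≤ t →
      m t ≤ m s + ENNReal.ofReal (k * (g t - g s)))
    (hsmall : m s₀ + ENNReal.ofReal (c * (g t₀ - g s₀)) < ENNReal.ofReal D) :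
    ∀ t ∈ Icc s₀ t₀, m t ≤ ENNReal.ofReal D := by
  by_contra! hbad
  obtain ⟨t₁, ht₁, hmt₁⟩ := hbad
  set S : Set ℝ := {τ | τ ∈ Icc s₀ t₀ ∧ ENNReal.ofReal D < m τ} with hS
  have hne : S.Nonempty := ⟨t₁, ht₁, hmt₁⟩
  have hbdd : BddBelow S := ⟨s₀, fun τ hτ => hτ.1.1⟩
  set σ := sInf S with hσ
  have hσ1 : s₀ ≤ σ := le_csInf hne fun τ hτ => hτ.1.1
  have hσ2 : σ ≤ t₀ := (csInf_le hbdd ⟨ht₁, hmt₁⟩).trans ht₁.2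
  have hσI : σ ∈ Icc s₀ t₀ := ⟨hσ1, hσ2⟩
  have hs₀I : s₀ ∈ Icc s₀ t₀ := ⟨le_rfl, hσ1.trans hσ2⟩
  have ht₀I : t₀ ∈ Icc s₀ t₀ := ⟨hσ1.trans hσ2, le_rfl⟩
  have hlt : ∀ τ ∈ Icc s₀ t₀, τ < σ → m τ ≤ ENNReal.ofReal D := fun τ hτ hτσ =>
    not_lt.1 fun h => notMem_of_lt_csInf hτσ hbdd ⟨hτ, h⟩
  -- At the infimum `σ` of the bad times the threshold still holds strictly, since the sharp
  -- increment bound asks for control only on the open interval before `σ`.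
  have hσm : m σ < ENNReal.ofReal D := by
    refine lt_of_le_of_lt ((hD s₀ hs₀I σ hσI hσ1 fun τ hτ => ?_).trans ?_) hsmall
    · exact hlt τ ⟨hτ.1.le, hτ.2.le.trans hσ2⟩ hτ.2
    · have := hmono hσI ht₀I hσ2
      gcongr
  -- The crude constant `k`, however large, gives upper semicontinuity from the right at `σ`; so
  -- there are no bad times just after `σ`, a contradiction. Continuity of `m` is not needed.
  have hlim : Tendsto (fun r => m σ + ENNReal.ofReal (k * (g r - g σ))) (𝓝[Icc s₀ t₀] σ)
      (𝓝 (m σ + ENNReal.ofReal (k * (g σ - g σ)))) := by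
    refine Tendsto.const_add _ (ENNReal.continuous_ofReal.continuousAt.tendsto.comp ?_)
    exact ((hg σ hσI).sub_const _).const_mul k
  rw [sub_self, mul_zero, ENNReal.ofReal_zero, add_zero] at hlim
  have hev := hlim.eventually (gt_mem_nhds hσm)
  rw [eventually_nhdsWithin_iff, Metric.eventually_nhds_iff] at hev
  obtain ⟨δ, hδ, hball⟩ := hev
  obtain ⟨b, hb, hbσ⟩ := exists_lt_of_csInf_lt hne (show sInf S < σ + δ by linarith)
  have hσb : σ ≤ b := csInf_le hbdd hb
  have h1 := hball (y := b) (by rw [Real.dist_eq, abs_of_nonneg (by linarith)]; linarith) hb.1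
  exact absurd (hk σ hσI b hb.1 hσb) (not_le.2 (h1.trans hb.2))


lemma lintegral_ofReal_interaction_le {κ : ℝ} (hκ : 0 < κ) (lam : ℝ) {u : E3 → E3 → ℝ}
    (hu : Continuous (Function.uncurry u)) (hu0 : ∀ x v, 0 ≤ u x v)
    {a b α β D : ℝ} (ha : 0 < a) (hb : 0 < b) (hβ : |β| ^ 3 = b ^ 7)
    (hA : ∀ x v, u x v ≤ a ^ 7) (hD0 : 0 ≤ D)
    (hD : ∫⁻ z : E3 × E3, ENNReal.ofReal (‖α • z.1 + β • z.2‖ ^ 4 * u z.1 z.2) ≤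
      ENNReal.ofReal D) :
    ∫⁻ z : E3 × E3, ENNReal.ofReal
        (‖α • z.1 + β • z.2‖ ^ 3 * ‖field κ lam u z.1‖ * u z.1 z.2) ≤
      ENNReal.ofReal ((interactionConst κ lam).toReal * (a / b) ^ 5 * D ^ (9 / 7 : ℝ)) := by
  have hA' : ∀ x v, ‖u x v‖ₑ ≤ ENNReal.ofReal (a ^ 7) := fun x v => by
    rw [Real.enorm_of_nonneg (hu0 x v)]
    exact ENNReal.ofReal_le_ofReal (hA x v)
  have h := lintegral_interaction_le κ lam hu (α := α) ha hb hβ hA'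
  have e4 : ∀ z : E3 × E3, ENNReal.ofReal (‖α • z.1 + β • z.2‖ ^ 4 * u z.1 z.2) =
      ‖α • z.1 + β • z.2‖ₑ ^ 4 * ‖u z.1 z.2‖ₑ := fun z => by
    rw [ENNReal.ofReal_mul (by positivity), ENNReal.ofReal_pow (norm_nonneg _), ofReal_norm,
      Real.enorm_of_nonneg (hu0 _ _)]
  have e3 : ∀ z : E3 × E3, ENNReal.ofReal
      (‖α • z.1 + β • z.2‖ ^ 3 * ‖field κ lam u z.1‖ * u z.1 z.2) =
      ‖α • z.1 + β • z.2‖ₑ ^ 3 * ‖field κ lam u z.1‖ₑ * ‖u z.1 z.2‖ₑ := fun z => by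
    rw [ENNReal.ofReal_mul (by positivity), ENNReal.ofReal_mul (by positivity),
      ENNReal.ofReal_pow (norm_nonneg _), ofReal_norm, ofReal_norm,
      Real.enorm_of_nonneg (hu0 _ _)]
  simp_rw [e3]
  simp_rw [e4] at hD
  refine h.trans ?_
  rw [ENNReal.ofReal_mul (by positivity), ENNReal.ofReal_mul (by positivity),
    ENNReal.ofReal_toReal (interactionConst_ne_top hκ lam),
    ← ENNReal.ofReal_rpow_of_nonneg hD0 (by norm_num)]
  gcongr

/-! ### Derivatives of the two weights along characteristics -/

section Weights

variable {F : Type*} [NormedAddCommGroup F] [NormedSpace ℝ F]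

lemma contDiff_norm_pow_four {g : F → E3} (hg : ContDiff ℝ 1 g) :
    ContDiff ℝ 1 fun z => ‖g z‖ ^ 4 := by
  have := (hg.norm_sq ℝ).pow 2
  simpa only [← pow_mul] using this

lemma hasDerivAt_norm_pow_four {γ : ℝ → E3} {γ' : E3} {s : ℝ} (h : HasDerivAt γ γ' s) :
    HasDerivAt (fun r => ‖γ r‖ ^ 4) (4 * ‖γ s‖ ^ 2 * inner ℝ (γ s) γ') s := by
  have h2 := h.norm_sq.pow 2
  have e : ((fun r => ‖γ r‖ ^ 2) ^ 2 : ℝ → ℝ) = fun r => ‖γ r‖ ^ 4 := by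
    ext r
    simp only [Pi.pow_apply, ← pow_mul]
  rw [e] at h2
  refine h2.congr_deriv ?_
  push_cast
  ring

/-- The weight used for short times. -/
def earlyWeight (q : ℝ × E3 × E3) : ℝ := Real.exp (-4 * q.1) * (‖q.2.1‖ ^ 4 + ‖q.2.2‖ ^ 4)

lemma contDiff_earlyWeight : ContDiff ℝ 1 earlyWeight :=
  (contDiff_const.mul contDiff_fst).exp.mul
    ((contDiff_norm_pow_four (contDiff_fst.comp contDiff_snd)).add
      (contDiff_norm_pow_four (contDiff_snd.comp contDiff_snd)))

lemma earlyWeight_nonneg (q : ℝ × E3 × E3) : 0 ≤ earlyWeight q := by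
  unfold earlyWeight
  positivity

/-- The damping `e^(-4t)` absorbs the free-streaming term, by `|x|^3 |v| ≤ |x|^4 + |v|^4`, and the
magnetic term is orthogonal to `v`. Only the work of the field remains. -/
lemma fderiv_earlyWeight_le {t : ℝ} (ht : 0 ≤ t) (x v e b : E3) :
    fderiv ℝ earlyWeight (t, x, v) (1, v, -(e + wedge v b)) ≤ 4 * ‖v‖ ^ 3 * ‖e‖ := by
  have h1 : HasDerivAt (fun s : ℝ => Real.exp (-4 * (t + s))) (Real.exp (-4 * t) * -4) 0 := by
    have := (((hasDerivAt_id (0 : ℝ)).const_add t).const_mul (-4)).exp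
    simpa using this
  have h2 := h1.mul ((hasDerivAt_norm_pow_four (hasDerivAt_add_smul x v)).add
    (hasDerivAt_norm_pow_four (hasDerivAt_add_smul v (-(e + wedge v b)))))
  rw [fderiv_apply_of_hasDerivAt (contDiff_earlyWeight.differentiable (by simp) _)
    (h2.congr_of_eventuallyEq (Eventually.of_forall fun s => by simp [earlyWeight]))]
  have h0 : inner ℝ v (-(e + wedge v b)) = -inner ℝ v e := by
    rw [inner_neg_right, inner_add_right, inner_wedge_self, add_zero]
  simp only [Pi.add_apply, zero_smul, add_zero, h0]
  have hx := (abs_le.1 (abs_real_inner_le_norm x v)).2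
  have hv := (abs_le.1 (abs_real_inner_le_norm v e)).1
  have hexp : Real.exp (-4 * t) ≤ 1 := Real.exp_le_one_iff.2 (by linarith)
  have hexp0 := Real.exp_pos (-4 * t)
  have i1 : ‖x‖ ^ 2 * inner ℝ x v ≤ ‖x‖ ^ 3 * ‖v‖ := by
    calc _ ≤ ‖x‖ ^ 2 * (‖x‖ * ‖v‖) := by gcongr
      _ = _ := by ring
  have i2 : ‖v‖ ^ 2 * -inner ℝ v e ≤ ‖v‖ ^ 3 * ‖e‖ := by
    calc _ ≤ ‖v‖ ^ 2 * (‖v‖ * ‖e‖) := by gcongr; linarith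
      _ = _ := by ring
  have i3 : ‖x‖ ^ 3 * ‖v‖ ≤ ‖x‖ ^ 4 + ‖v‖ ^ 4 := by
    rcases le_total ‖x‖ ‖v‖ with h | h
    · calc ‖x‖ ^ 3 * ‖v‖ ≤ ‖v‖ ^ 3 * ‖v‖ := by gcongr
        _ = ‖v‖ ^ 4 := by ring
        _ ≤ _ := by linarith [pow_nonneg (norm_nonneg x) 4]
    · calc ‖x‖ ^ 3 * ‖v‖ ≤ ‖x‖ ^ 3 * ‖x‖ := by gcongr
        _ = ‖x‖ ^ 4 := by ring
        _ ≤ _ := by linarith [pow_nonneg (norm_nonneg v) 4]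
  calc _ = Real.exp (-4 * t) * (4 * (‖x‖ ^ 2 * inner ℝ x v) + 4 * (‖v‖ ^ 2 * -inner ℝ v e) -
        4 * (‖x‖ ^ 4 + ‖v‖ ^ 4)) := by ring
    _ ≤ Real.exp (-4 * t) * (4 * (‖v‖ ^ 3 * ‖e‖)) := by
        gcongr
        linarith
    _ ≤ 1 * (4 * (‖v‖ ^ 3 * ‖e‖)) := by gcongr
    _ = _ := by ring

/-- The weight of the Eulerian moment. -/
def lateWeight (q : ℝ × E3 × E3) : ℝ := ‖q.2.1 - q.1 • q.2.2‖ ^ 4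

lemma contDiff_lateWeight : ContDiff ℝ 1 lateWeight :=
  contDiff_norm_pow_four ((contDiff_fst.comp contDiff_snd).sub
    (contDiff_fst.smul (contDiff_snd.comp contDiff_snd)))

lemma lateWeight_nonneg (q : ℝ × E3 × E3) : 0 ≤ lateWeight q := by
  unfold lateWeight
  positivity

/-- Free streaming preserves `y = x - t v`, so only the force contributes. In `t y · (v ∧ b)` one
may replace `t v = x - y` by `x`, because `y · (y ∧ b) = 0`. -/
lemma fderiv_lateWeight_le {t : ℝ} (ht : 0 ≤ t) (x v e b : E3) :
    fderiv ℝ lateWeight (t, x, v) (1, v, -(e + wedge v b)) ≤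
      4 * ‖x - t • v‖ ^ 3 * (t * ‖e‖ + ‖wedge x b‖) := by
  set w : E3 := e + wedge v b with hw
  have hγ : HasDerivAt (fun s : ℝ => (x + s • v) - (t + s) • (v + s • -w)) (t • w) 0 := by
    have h := (hasDerivAt_add_smul x v).sub
      (((hasDerivAt_id (0 : ℝ)).const_add t).smul (hasDerivAt_add_smul v (-w)))
    refine h.congr_deriv ?_
    simp
  have h2 := hasDerivAt_norm_pow_four hγ
  rw [fderiv_apply_of_hasDerivAt (contDiff_lateWeight.differentiable (by simp) _)
    (h2.congr_of_eventuallyEq (Eventually.of_forall fun s => by simp [lateWeight]))]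
  simp only [zero_smul, add_zero]
  set y := x - t • v with hy
  have e1 : inner ℝ y (t • w) = t * inner ℝ y e + inner ℝ y (wedge x b) := by
    have e2 : t * inner ℝ y (wedge v b) = inner ℝ y (wedge x b) := by
      rw [hy, inner_sub_left, inner_sub_left, real_inner_smul_left, real_inner_smul_left,
        inner_wedge_self, inner_wedge_self, inner_wedge_swap x v b]
      ring
    rw [real_inner_smul_right, hw, inner_add_right, mul_add, e2]
  have j1 := (abs_le.1 (abs_real_inner_le_norm y e)).2
  have j2 := (abs_le.1 (abs_real_inner_le_norm y (wedge x b))).2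
  rw [e1]
  calc _ ≤ 4 * ‖y‖ ^ 2 * (t * (‖y‖ * ‖e‖) + ‖y‖ * ‖wedge x b‖) := by gcongr
    _ = _ := by ring

end Weights

/-! ### Increments of the weighted moments -/

section Increments

variable {κ lam T : ℝ} {B : ℝ → E3 → E3} {fin : E3 → E3 → ℝ} {f : ℝ → E3 → E3 → ℝ}

lemma IsClassicalSolution.continuous_uncurry (hf : IsClassicalSolution κ lam T B fin f) {t : ℝ}
    (ht : t ∈ Icc 0 T) : Continuous (Function.uncurry (f t)) :=
  hf.isTransported.continuous_slice ht

/-- The interaction estimate with `α = 0`, `β = 1`; the factor `e^4` undoes the damping of the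
weight on `[0, 1]`. -/
lemma IsClassicalSolution.early_increment (hf : IsClassicalSolution κ lam T B fin f) (hκ : 0 < κ)
    {a D : ℝ} (ha : 0 < a) (hA : ∀ t ∈ Icc 0 T, ∀ x v, f t x v ≤ a ^ 7) (hD0 : 0 ≤ D) {s t : ℝ}
    (hs : 0 ≤ s) (hst : s ≤ t) (ht1 : t ≤ 1) (htT : t ≤ T)
    (hD : ∀ τ ∈ Ioo s t, ∫⁻ z : E3 × E3, ENNReal.ofReal (earlyWeight (τ, z) * f τ z.1 z.2) ≤
      ENNReal.ofReal D) :
    ∫⁻ z : E3 × E3, ENNReal.ofReal (earlyWeight (t, z) * f t z.1 z.2) ≤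
      (∫⁻ z : E3 × E3, ENNReal.ofReal (earlyWeight (s, z) * f s z.1 z.2)) +
      ENNReal.ofReal (4 * ((interactionConst κ lam).toReal * a ^ 5 *
        (Real.exp 4 * D) ^ (9 / 7 : ℝ)) * (t - s)) := by
  obtain ⟨C, hC⟩ := hf.field_bounded
  set c := 4 * ((interactionConst κ lam).toReal * a ^ 5 * (Real.exp 4 * D) ^ (9 / 7 : ℝ)) with hc
  have hc0 : 0 ≤ c := by positivity
  have hsub : ∀ τ ∈ Ioo s t, τ ∈ Icc 0 T := fun τ hτ => ⟨hs.trans hτ.1.le, hτ.2.le.trans htT⟩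
  have key := hf.isTransported.lintegral_le hC contDiff_earlyWeight earlyWeight_nonneg
    (h := fun τ z => 4 * ‖z.2‖ ^ 3 * ‖field κ lam (f τ) z.1‖) (G := fun τ => c * τ)
    (G' := fun _ => c) hs hst htT ?_ (fun τ _ z => by positivity) ?_ (by fun_prop)
    (fun τ _ => by simpa using (hasDerivAt_id τ).const_mul c) (fun _ _ => hc0) ?_
  · rw [← mul_sub] at key
    exact key
  · intro τ hτ
    have := (field_measurable κ lam (hf.continuous_uncurry (hsub τ hτ))).comp
      (measurable_fst : Measurable (Prod.fst : E3 × E3 → E3))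
    exact (by fun_prop : Measurable fun z : E3 × E3 => 4 * ‖z.2‖ ^ 3).mul this.norm
  · intro τ hτ
    exact ae_of_all _ fun x v => fderiv_earlyWeight_le (hs.trans hτ.1.le) x v _ _
  · intro τ hτ
    have hτI := hsub τ hτ
    have hnn := hf.nonneg τ hτI
    have h4 : ∫⁻ z : E3 × E3, ENNReal.ofReal (‖(0 : ℝ) • z.1 + (1 : ℝ) • z.2‖ ^ 4 * f τ z.1 z.2) ≤
        ENNReal.ofReal (Real.exp 4 * D) := by
      calc _ ≤ ∫⁻ z : E3 × E3, ENNReal.ofReal (Real.exp 4) *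
            ENNReal.ofReal (earlyWeight (τ, z) * f τ z.1 z.2) := by
            refine lintegral_mono fun z => ?_
            rw [← ENNReal.ofReal_mul (Real.exp_pos _).le, ← mul_assoc]
            refine ENNReal.ofReal_le_ofReal (mul_le_mul_of_nonneg_right ?_ (hnn _ _))
            rw [zero_smul, zero_add, one_smul, earlyWeight, ← mul_assoc, ← Real.exp_add]
            have h1 : 1 ≤ Real.exp (4 + -4 * τ) :=
              Real.one_le_exp (by linarith [hτ.2.le.trans ht1])
            have h2 : 0 ≤ ‖z.1‖ ^ 4 := by positivity
            have h3 : 0 ≤ ‖z.2‖ ^ 4 := by positivity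
            simp only
            nlinarith
        _ = ENNReal.ofReal (Real.exp 4) *
            ∫⁻ z : E3 × E3, ENNReal.ofReal (earlyWeight (τ, z) * f τ z.1 z.2) :=
            lintegral_const_mul' _ _ ENNReal.ofReal_ne_top
        _ ≤ _ := by
            rw [ENNReal.ofReal_mul (Real.exp_pos _).le]
            gcongr
            exact hD τ hτ
    have h3 := lintegral_ofReal_interaction_le hκ lam (hf.continuous_uncurry hτI) hnn (α := 0)
      (β := 1) (b := 1) ha one_pos (by norm_num) (hA τ hτI) (by positivity) h4
    simp only [zero_smul, zero_add, one_smul, div_one] at h3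
    calc _ = ∫⁻ z : E3 × E3, ENNReal.ofReal 4 *
          ENNReal.ofReal (‖z.2‖ ^ 3 * ‖field κ lam (f τ) z.1‖ * f τ z.1 z.2) := by
          refine lintegral_congr fun z => ?_
          rw [← ENNReal.ofReal_mul (by norm_num)]
          congr 1
          ring
      _ = ENNReal.ofReal 4 * ∫⁻ z : E3 × E3,
          ENNReal.ofReal (‖z.2‖ ^ 3 * ‖field κ lam (f τ) z.1‖ * f τ z.1 z.2) :=
          lintegral_const_mul' _ _ ENNReal.ofReal_ne_top
      _ ≤ _ := by
          rw [hc, ENNReal.ofReal_mul (by norm_num)]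
          gcongr

/-- Splitting at `r = 1 / η`. A small `η` makes the coefficient of the fourth moment small even for
large `B₀`, at the price of a multiple of the mass. -/
lemma pow_three_le_add {r η : ℝ} (hr : 0 ≤ r) (hη : 0 < η) : r ^ 3 ≤ η * r ^ 4 + η⁻¹ ^ 3 := by
  rcases le_total r η⁻¹ with h | h
  · have h1 : r ^ 3 ≤ η⁻¹ ^ 3 := by gcongr
    have h2 : 0 ≤ η * r ^ 4 := by positivity
    linarith
  · have h1 : 1 ≤ η * r := by
      rw [inv_le_iff_one_le_mul₀ hη] at h
      linarith
    have h2 : r ^ 3 ≤ η * r * r ^ 3 := le_mul_of_one_le_left (by positivity) h1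
    have h3 : 0 ≤ η⁻¹ ^ 3 := by positivity
    nlinarith

/-- Both the interaction and the magnetic contribution are bounded by a constant times `τ^(-q)`, `q
= 3 / c - 1`; the last factor is the integral of `τ^(-q)` over `[s, t]`. -/
lemma IsClassicalSolution.late_increment (hf : IsClassicalSolution κ lam T B fin f) (hκ : 0 < κ)
    {c B₀ : ℝ} (hc : c ∈ Ioo (7 / 5 : ℝ) (3 / 2)) (hB₀ : 0 < B₀) (hB : MagneticDecay c B₀ T B)
    {a D N η : ℝ} (ha : 0 < a) (hA : ∀ t ∈ Icc 0 T, ∀ x v, f t x v ≤ a ^ 7) (hD0 : 0 ≤ D)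
    (hN0 : 0 ≤ N) (hη : 0 < η)
    (hN : ∀ t ∈ Icc 0 T, ∫⁻ z : E3 × E3, ENNReal.ofReal (f t z.1 z.2) ≤ ENNReal.ofReal N)
    {s t : ℝ} (hs : 1 ≤ s) (hst : s ≤ t) (htT : t ≤ T)
    (hD : ∀ τ ∈ Ioo s t, eulerianMoment 4 τ (f τ) ≤ ENNReal.ofReal D) :
    eulerianMoment 4 t (f t) ≤ eulerianMoment 4 s (f s) +
      ENNReal.ofReal ((4 * ((interactionConst κ lam).toReal * a ^ 5 * D ^ (9 / 7 : ℝ)) +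
          4 * B₀ * (η * D + η⁻¹ ^ 3 * N)) *
        (-(t ^ (1 - (3 / c - 1)) / ((3 / c - 1) - 1)) -
          -(s ^ (1 - (3 / c - 1)) / ((3 / c - 1) - 1)))) := by
  obtain ⟨C, hC⟩ := hf.field_bounded
  obtain ⟨hc1, hc2⟩ := hc
  have hcpos : 0 < c := by linarith
  set q := 3 / c - 1 with hq
  -- The range of `c` enters here: `c < 3/2` makes `τ^(-q)` integrable at infinity, and `c > 7/5`
  -- makes it dominate the decay `τ^(-8/7)` of the interaction.
  have hq1 : 1 < q := by
    have : 2 < 3 / c := by rw [lt_div_iff₀ hcpos]; linarith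
    linarith
  have hq2 : q ≤ 8 / 7 := by
    have : 3 / c ≤ 15 / 7 := by rw [div_le_iff₀ hcpos]; linarith
    linarith
  set I := (interactionConst κ lam).toReal
  set M := 4 * (I * a ^ 5 * D ^ (9 / 7 : ℝ)) + 4 * B₀ * (η * D + η⁻¹ ^ 3 * N) with hM
  have hI0 : 0 ≤ I := ENNReal.toReal_nonneg
  have hM0 : 0 ≤ M := by positivity
  have hsub : ∀ τ ∈ Ioo s t, τ ∈ Icc 0 T := fun τ hτ => ⟨by linarith [hτ.1], hτ.2.le.trans htT⟩
  have hpos : ∀ τ ∈ Icc s t, 0 < τ := fun τ hτ => by linarith [hτ.1]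
  have hGd : ∀ τ, 0 < τ → HasDerivAt (fun r : ℝ => M * -(r ^ (1 - q) / (q - 1)))
      (M * τ ^ (-q)) τ := by
    intro τ hτ
    have h := (((Real.hasDerivAt_rpow_const (p := 1 - q) (Or.inl hτ.ne')).div_const
      (q - 1)).neg).const_mul M
    refine h.congr_deriv ?_
    have e : 1 - q - 1 = -q := by ring
    have hne : q - 1 ≠ 0 := by linarith
    rw [e]
    field_simp
    ring
  have key := hf.isTransported.lintegral_le hC contDiff_lateWeight lateWeight_nonneg
    (h := fun τ z => 4 * ‖z.1 - τ • z.2‖ ^ 3 *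
      (τ * ‖field κ lam (f τ) z.1‖ + B₀ * τ ^ (-q)))
    (G := fun r : ℝ => M * -(r ^ (1 - q) / (q - 1))) (G' := fun τ => M * τ ^ (-q))
    (by linarith) hst htT ?_ ?_ ?_ (fun τ hτ => (hGd τ (hpos τ hτ)).continuousAt.continuousWithinAt)
    (fun τ hτ => hGd τ (hpos τ (Ioo_subset_Icc_self hτ))) ?_ ?_
  · rw [← mul_sub] at key
    exact key
  · intro τ hτ
    have := (field_measurable κ lam (hf.continuous_uncurry (hsub τ hτ))).comp
      (measurable_fst : Measurable (Prod.fst : E3 × E3 → E3))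
    exact (by fun_prop : Measurable fun z : E3 × E3 => 4 * ‖z.1 - τ • z.2‖ ^ 3).mul
      ((this.norm.const_mul τ).add_const _)
  · intro τ hτ z
    have := hpos τ (Ioo_subset_Icc_self hτ)
    positivity
  · intro τ hτ
    have hτ0 := hpos τ (Ioo_subset_Icc_self hτ)
    have hb := hB.bound_b τ ⟨hτ0, (hsub τ hτ).2⟩
    rw [eLpNorm_exponent_top] at hb
    filter_upwards [ae_le_eLpNormEssSup (f := fun x => wedge x (B τ x)) (μ := volume)] with x hx v
    have hx' : ‖wedge x (B τ x)‖ ≤ B₀ * τ ^ (-q) := by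
      rw [← ENNReal.ofReal_le_ofReal_iff (by positivity), ofReal_norm]
      exact hx.trans hb
    refine (fderiv_lateWeight_le hτ0.le x v _ _).trans ?_
    gcongr
  · intro τ hτ
    have := hpos τ (Ioo_subset_Icc_self hτ)
    positivity
  · intro τ hτ
    have hτI := hsub τ hτ
    have hτ0 := hpos τ (Ioo_subset_Icc_self hτ)
    have hτ1 : 1 ≤ τ := by linarith [hτ.1]
    have hnn := hf.nonneg τ hτI
    have hLD := hD τ hτ
    have h4 : ∫⁻ z : E3 × E3, ENNReal.ofReal (‖(1 : ℝ) • z.1 + (-τ) • z.2‖ ^ 4 * f τ z.1 z.2) ≤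
        ENNReal.ofReal D := by
      simpa only [eulerianMoment, one_smul, neg_smul, ← sub_eq_add_neg] using hLD
    have hb7 : |-τ| ^ 3 = (τ ^ (3 / 7 : ℝ)) ^ 7 := by
      rw [abs_neg, abs_of_pos hτ0, ← Real.rpow_natCast (τ ^ (3 / 7 : ℝ)), ← Real.rpow_mul hτ0.le,
        ← Real.rpow_natCast τ 3]
      norm_num
    have h3 := lintegral_ofReal_interaction_le hκ lam (hf.continuous_uncurry hτI) hnn (α := 1)
      (β := -τ) (b := τ ^ (3 / 7 : ℝ)) ha (by positivity) hb7 (hA τ hτI) hD0 h4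
    simp only [one_smul, neg_smul, ← sub_eq_add_neg] at h3
    -- The factor `τ` comes from the derivative of `x - τ v`, the fifth power from the interaction
    -- estimate with `b = τ^(3/7)`; together they give `τ^(1 - 15/7)`, and `τ ≥ 1` allows the weaker
    -- exponent.
    have hdecay : τ * (a / τ ^ (3 / 7 : ℝ)) ^ 5 ≤ a ^ 5 * τ ^ (-q) := by
      have e1 : τ * (a / τ ^ (3 / 7 : ℝ)) ^ 5 = a ^ 5 * τ ^ (-(8 / 7) : ℝ) := by
        have e2 : τ ^ (-(8 / 7) : ℝ) = τ / (τ ^ (3 / 7 : ℝ)) ^ 5 := by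
          rw [← Real.rpow_natCast (τ ^ (3 / 7 : ℝ)), ← Real.rpow_mul hτ0.le]
          nth_rw 2 [← Real.rpow_one τ]
          rw [← Real.rpow_sub hτ0]
          norm_num
        rw [e2, div_pow]
        ring
      rw [e1]
      gcongr
    have hBτ : 0 ≤ 4 * B₀ * τ ^ (-q) := by positivity
    have hm4 : Measurable fun z : E3 × E3 =>
        ENNReal.ofReal (‖z.1 - τ • z.2‖ ^ 4 * f τ z.1 z.2) := by
      have h1 : Continuous fun z : E3 × E3 => ‖z.1 - τ • z.2‖ ^ 4 := by fun_prop
      exact (h1.mul (hf.continuous_uncurry hτI)).measurable.ennreal_ofReal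
    have hm1 : Measurable fun z : E3 × E3 => ENNReal.ofReal (f τ z.1 z.2) :=
      (hf.continuous_uncurry hτI).measurable.ennreal_ofReal
    have hm41 : Measurable fun z : E3 × E3 => ENNReal.ofReal (4 * B₀ * τ ^ (-q) * η) *
          ENNReal.ofReal (‖z.1 - τ • z.2‖ ^ 4 * f τ z.1 z.2) +
        ENNReal.ofReal (4 * B₀ * τ ^ (-q) * η⁻¹ ^ 3) * ENNReal.ofReal (f τ z.1 z.2) :=
      (hm4.const_mul _).add (hm1.const_mul _)
    calc _ ≤ ∫⁻ z : E3 × E3, (ENNReal.ofReal (4 * τ) *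
            ENNReal.ofReal (‖z.1 - τ • z.2‖ ^ 3 * ‖field κ lam (f τ) z.1‖ * f τ z.1 z.2) +
          (ENNReal.ofReal (4 * B₀ * τ ^ (-q) * η) *
              ENNReal.ofReal (‖z.1 - τ • z.2‖ ^ 4 * f τ z.1 z.2) +
            ENNReal.ofReal (4 * B₀ * τ ^ (-q) * η⁻¹ ^ 3) * ENNReal.ofReal (f τ z.1 z.2))) := by
          refine lintegral_mono fun z => ?_
          have hfz := hnn z.1 z.2
          rw [← ENNReal.ofReal_mul (by positivity), ← ENNReal.ofReal_mul (by positivity),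
            ← ENNReal.ofReal_mul (by positivity), ← ENNReal.ofReal_add (by positivity)
            (by positivity), ← ENNReal.ofReal_add (by positivity) (by positivity)]
          refine ENNReal.ofReal_le_ofReal ?_
          have h1 := mul_le_mul_of_nonneg_left (mul_le_mul_of_nonneg_right
            (pow_three_le_add (norm_nonneg (z.1 - τ • z.2)) hη) hfz) hBτ
          nlinarith
      _ = ENNReal.ofReal (4 * τ) * (∫⁻ z : E3 × E3,
            ENNReal.ofReal (‖z.1 - τ • z.2‖ ^ 3 * ‖field κ lam (f τ) z.1‖ * f τ z.1 z.2)) +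
          (ENNReal.ofReal (4 * B₀ * τ ^ (-q) * η) *
              (∫⁻ z : E3 × E3, ENNReal.ofReal (‖z.1 - τ • z.2‖ ^ 4 * f τ z.1 z.2)) +
            ENNReal.ofReal (4 * B₀ * τ ^ (-q) * η⁻¹ ^ 3) *
              ∫⁻ z : E3 × E3, ENNReal.ofReal (f τ z.1 z.2)) := by
          rw [lintegral_add_right _ hm41, lintegral_add_right _ (hm1.const_mul _),
            lintegral_const_mul' _ _ ENNReal.ofReal_ne_top,
            lintegral_const_mul' _ _ ENNReal.ofReal_ne_top,
            lintegral_const_mul' _ _ ENNReal.ofReal_ne_top]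
      _ ≤ ENNReal.ofReal (4 * τ) *
            ENNReal.ofReal (I * (a / τ ^ (3 / 7 : ℝ)) ^ 5 * D ^ (9 / 7 : ℝ)) +
          (ENNReal.ofReal (4 * B₀ * τ ^ (-q) * η) * ENNReal.ofReal D +
            ENNReal.ofReal (4 * B₀ * τ ^ (-q) * η⁻¹ ^ 3) * ENNReal.ofReal N) := by
          gcongr
          · exact hLD
          · exact hN τ hτI
      _ = ENNReal.ofReal (4 * τ * (I * (a / τ ^ (3 / 7 : ℝ)) ^ 5 * D ^ (9 / 7 : ℝ)) +
          (4 * B₀ * τ ^ (-q) * η * D + 4 * B₀ * τ ^ (-q) * η⁻¹ ^ 3 * N)) := by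
          rw [← ENNReal.ofReal_mul (by positivity), ← ENNReal.ofReal_mul (by positivity),
            ← ENNReal.ofReal_mul (by positivity), ← ENNReal.ofReal_add (by positivity)
            (by positivity), ← ENNReal.ofReal_add (by positivity) (by positivity)]
      _ ≤ _ := by
          refine ENNReal.ofReal_le_ofReal ?_
          have h1 : 4 * (I * D ^ (9 / 7 : ℝ)) * (τ * (a / τ ^ (3 / 7 : ℝ)) ^ 5) ≤
              4 * (I * D ^ (9 / 7 : ℝ)) * (a ^ 5 * τ ^ (-q)) := by gcongr
          rw [hM]
          linarith

end Increments


/-! ### Comparison of weights and initial data -/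

lemma add_pow_four_le {r s : ℝ} : (r + s) ^ 4 ≤ 8 * (r ^ 4 + s ^ 4) := by
  nlinarith [sq_nonneg (r - s), sq_nonneg (r ^ 2 - s ^ 2), sq_nonneg ((r - s) ^ 2),
    sq_nonneg (r * (r - s)), sq_nonneg (s * (r - s)), sq_nonneg (r + s)]

lemma norm_sub_smul_pow_four_le (x v : E3) (t : ℝ) :
    ‖x - t • v‖ ^ 4 ≤ 8 * (‖x‖ ^ 4 + t ^ 4 * ‖v‖ ^ 4) := by
  have h1 : ‖x - t • v‖ ≤ ‖x‖ + |t| * ‖v‖ := by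
    rw [← Real.norm_eq_abs, ← norm_smul]
    exact norm_sub_le _ _
  calc ‖x - t • v‖ ^ 4 ≤ (‖x‖ + |t| * ‖v‖) ^ 4 := by gcongr
    _ ≤ 8 * (‖x‖ ^ 4 + (|t| * ‖v‖) ^ 4) := add_pow_four_le
    _ = _ := by rw [mul_pow, Even.pow_abs (by decide)]

lemma norm_pow_four_add_le_phaseWeight (z : E3 × E3) :
    ‖z.1‖ ^ 4 + ‖z.2‖ ^ 4 ≤ phaseWeight z ^ 2 := by
  have h1 : 0 ≤ ‖z.1‖ ^ 2 := by positivity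
  have h2 : 0 ≤ ‖z.2‖ ^ 2 := by positivity
  have h3 : 0 ≤ ‖z.1‖ ^ 2 * ‖z.2‖ ^ 2 := by positivity
  unfold phaseWeight
  nlinarith

lemma phaseWeight_sq_le (z : E3 × E3) :
    phaseWeight z ^ 2 ≤ 3 * (1 + (‖z.1‖ ^ 4 + ‖z.2‖ ^ 4)) := by
  unfold phaseWeight
  nlinarith [sq_nonneg (‖z.1‖ ^ 2 - 1), sq_nonneg (‖z.2‖ ^ 2 - 1),
    sq_nonneg (‖z.1‖ ^ 2 - ‖z.2‖ ^ 2)]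

lemma lintegral_ofReal_mul_le {g p q : E3 × E3 → ℝ} {c : ℝ} (hc : 0 ≤ c) (hg : ∀ z, 0 ≤ g z)
    (hpq : ∀ z, p z ≤ c * q z) :
    ∫⁻ z, ENNReal.ofReal (p z * g z) ≤
      ENNReal.ofReal c * ∫⁻ z, ENNReal.ofReal (q z * g z) := by
  rw [← lintegral_const_mul' _ _ ENNReal.ofReal_ne_top]
  refine lintegral_mono fun z => ?_
  rw [← ENNReal.ofReal_mul hc, ← mul_assoc]
  exact ENNReal.ofReal_le_ofReal (mul_le_mul_of_nonneg_right (hpq z) (hg z))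

lemma le_of_ae_le {g : E3 × E3 → ℝ} (hg : Continuous g) {A : ℝ} (h : ∀ᵐ z, g z ≤ A)
    (z : E3 × E3) : g z ≤ A := by
  have : Measure.IsOpenPosMeasure (volume : Measure (E3 × E3)) := by
    rw [Measure.volume_eq_prod]
    infer_instance
  have hopen : IsOpen {z | A < g z} := isOpen_lt continuous_const hg
  have h0 : volume {z | A < g z} = 0 := by
    simpa [ae_iff] using h
  have hempty := hopen.measure_eq_zero_iff (μ := volume).1 h0
  by_contra hz
  exact (hempty ▸ (show z ∈ {z | A < g z} from not_le.1 hz) : z ∈ (∅ : Set (E3 × E3)))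

section Initial

variable {u : E3 → E3 → ℝ}

lemma le_of_normL1Linf_le (hu : Continuous (Function.uncurry u)) {A : ℝ} (hA : 0 ≤ A)
    (h : normL1Linf u ≤ ENNReal.ofReal A) (x v : E3) : u x v ≤ A := by
  refine le_of_ae_le hu ?_ (x, v)
  have h2 := le_add_self.trans h
  rw [eLpNorm_exponent_top] at h2
  filter_upwards [ae_le_eLpNormEssSup (f := fun z : E3 × E3 => u z.1 z.2) (μ := volume)] with z hz
  have h3 : ‖u z.1 z.2‖ ≤ A := by
    rw [← ENNReal.ofReal_le_ofReal_iff hA, ofReal_norm]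
    exact hz.trans h2
  exact (le_abs_self _).trans h3

lemma lintegral_ofReal_le_normL1Linf (hu0 : ∀ x v, 0 ≤ u x v) :
    ∫⁻ z : E3 × E3, ENNReal.ofReal (u z.1 z.2) ≤ normL1Linf u := by
  refine le_trans (le_of_eq ?_) le_self_add
  rw [eLpNorm_one_eq_lintegral_enorm]
  exact lintegral_congr fun z => (Real.enorm_of_nonneg (hu0 _ _)).symm

lemma lintegral_norm_pow_four_add (hu : Continuous (Function.uncurry u)) (hu0 : ∀ x v, 0 ≤ u x v) :
    ∫⁻ z : E3 × E3, ENNReal.ofReal ((‖z.1‖ ^ 4 + ‖z.2‖ ^ 4) * u z.1 z.2) =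
      velocityMoment 4 u + positionMoment 4 u := by
  have hm : Measurable fun z : E3 × E3 => ENNReal.ofReal (‖z.2‖ ^ 4 * u z.1 z.2) := by
    have h1 : Continuous fun z : E3 × E3 => ‖z.2‖ ^ 4 := by fun_prop
    exact (h1.mul hu).measurable.ennreal_ofReal
  rw [velocityMoment, positionMoment, ← lintegral_add_left hm]
  refine lintegral_congr fun z => ?_
  have := hu0 z.1 z.2
  rw [← ENNReal.ofReal_add (by positivity) (by positivity)]
  congr 1
  ring

end Initial

/-! ### The bootstrap -/

section Global

variable {κ lam T : ℝ} {B : ℝ → E3 → E3} {fin : E3 → E3 → ℝ} {f : ℝ → E3 → E3 → ℝ}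

/-- The moments of a solution are bounded on `[0, T]`, without any uniformity. -/
lemma IsClassicalSolution.exists_moment_bound (hf : IsClassicalSolution κ lam T B fin f)
    (hT : 0 ≤ T)
    (h0 : normL1Linf (f 0) + velocityMoment 4 (f 0) + positionMoment 4 (f 0) ≠ ⊤) :
    ∃ K : ℝ, 0 ≤ K ∧ ∀ t ∈ Icc 0 T,
      ∫⁻ z : E3 × E3, ENNReal.ofReal (earlyWeight (t, z) * f t z.1 z.2) ≤ ENNReal.ofReal K ∧
      eulerianMoment 4 t (f t) ≤ ENNReal.ofReal K := by
  obtain ⟨C, hC⟩ := hf.field_bounded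
  have h0T : (0 : ℝ) ∈ Icc 0 T := ⟨le_rfl, hT⟩
  have hu := hf.continuous_uncurry h0T
  have hu0 := hf.nonneg 0 h0T
  have hfin : ∫⁻ z : E3 × E3, ENNReal.ofReal (phaseWeight z ^ 2 * f 0 z.1 z.2) ≠ ⊤ := by
    refine ne_top_of_le_ne_top (ENNReal.mul_ne_top (ENNReal.ofReal_ne_top (r := 3)) h0)
      ((lintegral_ofReal_mul_le (by norm_num) (fun z => hu0 z.1 z.2) phaseWeight_sq_le).trans ?_)
    gcongr
    have hm : Measurable fun z : E3 × E3 => ENNReal.ofReal (f 0 z.1 z.2) :=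
      hu.measurable.ennreal_ofReal
    calc _ = ∫⁻ z : E3 × E3, (ENNReal.ofReal (f 0 z.1 z.2) +
          ENNReal.ofReal ((‖z.1‖ ^ 4 + ‖z.2‖ ^ 4) * f 0 z.1 z.2)) := by
          refine lintegral_congr fun z => ?_
          have := hu0 z.1 z.2
          rw [← ENNReal.ofReal_add (by positivity) (by positivity)]
          congr 1
          ring
      _ = (∫⁻ z : E3 × E3, ENNReal.ofReal (f 0 z.1 z.2)) +
          (velocityMoment 4 (f 0) + positionMoment 4 (f 0)) := by
          rw [lintegral_add_left hm, lintegral_norm_pow_four_add hu hu0]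
      _ ≤ _ := by
          rw [add_assoc]
          gcongr
          exact lintegral_ofReal_le_normL1Linf hu0
  obtain ⟨K, hK0, hK⟩ := hf.isTransported.exists_phaseWeight_bound hC hfin
  refine ⟨8 * (1 + T ^ 4) * K, by positivity, fun t ht => ?_⟩
  have hnn : ∀ z : E3 × E3, 0 ≤ f t z.1 z.2 := fun z => hf.nonneg t ht z.1 z.2
  have hgen : ∀ p : E3 × E3 → ℝ, (∀ z, p z ≤ 8 * (1 + T ^ 4) * phaseWeight z ^ 2) →
      ∫⁻ z : E3 × E3, ENNReal.ofReal (p z * f t z.1 z.2) ≤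
        ENNReal.ofReal (8 * (1 + T ^ 4) * K) := by
    intro p hp
    rw [ENNReal.ofReal_mul (by positivity)]
    refine (lintegral_ofReal_mul_le (by positivity) hnn hp).trans ?_
    gcongr
    exact hK t ht
  have hT4 : 0 ≤ T ^ 4 := by positivity
  constructor
  · refine hgen _ fun z => ?_
    have h1 : Real.exp (-4 * t) ≤ 1 := Real.exp_le_one_iff.2 (by linarith [ht.1])
    have h2 : 0 ≤ ‖z.1‖ ^ 4 + ‖z.2‖ ^ 4 := by positivity
    calc earlyWeight (t, z) ≤ 1 * (‖z.1‖ ^ 4 + ‖z.2‖ ^ 4) :=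
          mul_le_mul_of_nonneg_right h1 h2
      _ ≤ 8 * (1 + T ^ 4) * phaseWeight z ^ 2 := by
          gcongr
          · linarith
          · exact norm_pow_four_add_le_phaseWeight z
  · refine hgen _ fun z => ?_
    have h1 : t ^ 4 ≤ T ^ 4 := pow_le_pow_left₀ ht.1 ht.2 4
    have h2 := norm_pow_four_add_le_phaseWeight z
    have h3 : 0 ≤ ‖z.1‖ ^ 4 := by positivity
    have h4 : 0 ≤ ‖z.2‖ ^ 4 := by positivity
    calc _ ≤ 8 * (‖z.1‖ ^ 4 + t ^ 4 * ‖z.2‖ ^ 4) := norm_sub_smul_pow_four_le _ _ _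
      _ ≤ 8 * ((1 + T ^ 4) * (‖z.1‖ ^ 4 + ‖z.2‖ ^ 4)) := by
          have h5 := mul_le_mul_of_nonneg_right h1 h4
          have h6 := mul_nonneg hT4 h3
          nlinarith
      _ ≤ 8 * ((1 + T ^ 4) * phaseWeight z ^ 2) := by gcongr
      _ = _ := by ring

/-- At `δ = 0` both inequalities are strict, the second reading `1/4 + 1/4 < 1`, and both sides are
continuous in `δ`. The value `η = (q - 1) / (16 B₀)` is chosen so that the magnetic part `4 B₀ η /
(q - 1)` is exactly `1/4`. -/
lemma exists_small_parameter (I B₀ q : ℝ) (hB₀ : 0 < B₀) (hq : 1 < q) :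
    ∃ δ : ℝ, 0 < δ ∧
      δ ^ 7 + 4 * (I * δ ^ 5 * (1 / 32 : ℝ) ^ (9 / 7 : ℝ)) < 1 / (32 * Real.exp 4) ∧
      1 / 4 + (4 * (I * δ ^ 5 * (1 : ℝ) ^ (9 / 7 : ℝ)) +
        4 * B₀ * ((q - 1) / (16 * B₀) * 1 + ((q - 1) / (16 * B₀))⁻¹ ^ 3 * δ ^ 7)) *
          (1 / (q - 1)) < 1 := by
  have hq' : 0 < q - 1 := by linarith
  have h1 : Tendsto (fun δ : ℝ => δ ^ 7 + 4 * (I * δ ^ 5 * (1 / 32 : ℝ) ^ (9 / 7 : ℝ)))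
      (𝓝[>] 0) (𝓝 (0 ^ 7 + 4 * (I * 0 ^ 5 * (1 / 32 : ℝ) ^ (9 / 7 : ℝ)))) :=
    (Continuous.tendsto (by fun_prop) 0).mono_left nhdsWithin_le_nhds
  have h2 : Tendsto (fun δ : ℝ => 1 / 4 + (4 * (I * δ ^ 5 * (1 : ℝ) ^ (9 / 7 : ℝ)) +
        4 * B₀ * ((q - 1) / (16 * B₀) * 1 + ((q - 1) / (16 * B₀))⁻¹ ^ 3 * δ ^ 7)) *
          (1 / (q - 1))) (𝓝[>] 0) (𝓝 (1 / 4 + (4 * (I * 0 ^ 5 * (1 : ℝ) ^ (9 / 7 : ℝ)) +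
        4 * B₀ * ((q - 1) / (16 * B₀) * 1 + ((q - 1) / (16 * B₀))⁻¹ ^ 3 * 0 ^ 7)) *
          (1 / (q - 1)))) :=
    (Continuous.tendsto (by fun_prop) 0).mono_left nhdsWithin_le_nhds
  have l1 : (0 : ℝ) ^ 7 + 4 * (I * 0 ^ 5 * (1 / 32 : ℝ) ^ (9 / 7 : ℝ)) < 1 / (32 * Real.exp 4) := by
    have : 0 < 1 / (32 * Real.exp 4) := by positivity
    simpa using this
  have l2 : 1 / 4 + (4 * (I * 0 ^ 5 * (1 : ℝ) ^ (9 / 7 : ℝ)) +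
        4 * B₀ * ((q - 1) / (16 * B₀) * 1 + ((q - 1) / (16 * B₀))⁻¹ ^ 3 * 0 ^ 7)) *
          (1 / (q - 1)) < 1 := by
    have : 4 * B₀ * ((q - 1) / (16 * B₀)) * (1 / (q - 1)) = 1 / 4 := by
      field_simp
      norm_num
    norm_num
    norm_num at this
    linarith
  obtain ⟨δ, hδ1, hδ2, hδ0⟩ := ((h1.eventually (gt_mem_nhds l1)).and
    ((h2.eventually (gt_mem_nhds l2)).and self_mem_nhdsWithin)).exists
  exact ⟨δ, hδ0, hδ1, hδ2⟩

/-- For small data, the Eulerian moment stays below `1`. -/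
lemma IsClassicalSolution.eulerianMoment_le_one (hf : IsClassicalSolution κ lam T B fin f)
    (hκ : 0 < κ) (hT : 0 < T) {c B₀ : ℝ} (hc : c ∈ Ioo (7 / 5 : ℝ) (3 / 2)) (hB₀ : 0 < B₀)
    (hB : MagneticDecay c B₀ T B) {δ : ℝ} (hδ : 0 < δ)
    (hδ1 : δ ^ 7 + 4 * ((interactionConst κ lam).toReal * δ ^ 5 * (1 / 32 : ℝ) ^ (9 / 7 : ℝ)) <
      1 / (32 * Real.exp 4))
    (hδ2 : 1 / 4 + (4 * ((interactionConst κ lam).toReal * δ ^ 5 * (1 : ℝ) ^ (9 / 7 : ℝ)) +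
        4 * B₀ * ((3 / c - 1 - 1) / (16 * B₀) * 1 +
          ((3 / c - 1 - 1) / (16 * B₀))⁻¹ ^ 3 * δ ^ 7)) * (1 / (3 / c - 1 - 1)) < 1)
    (h0 : normL1Linf (f 0) + velocityMoment 4 (f 0) + positionMoment 4 (f 0) ≤
      ENNReal.ofReal (δ ^ 7)) {t : ℝ} (ht : t ∈ Icc 0 T) :
    eulerianMoment 4 t (f t) ≤ 1 := by
  obtain ⟨C, hC⟩ := hf.field_bounded
  have h0T : (0 : ℝ) ∈ Icc 0 T := ⟨le_rfl, hT.le⟩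
  have hu := hf.continuous_uncurry h0T
  have hu0 := hf.nonneg 0 h0T
  have hδ7 : 0 < δ ^ 7 := by positivity
  have hnorm : normL1Linf (f 0) ≤ ENNReal.ofReal (δ ^ 7) := (by
    rw [add_assoc]; exact le_self_add : normL1Linf (f 0) ≤ _).trans h0
  have hA : ∀ τ ∈ Icc 0 T, ∀ x v, f τ x v ≤ δ ^ 7 := fun τ hτ x v =>
    hf.isTransported.le_of_initial_le hC
      (fun z => le_of_normL1Linf_le hu hδ7.le hnorm z.1 z.2) hτ (x, v)
  have hN : ∀ τ ∈ Icc 0 T, ∫⁻ z : E3 × E3, ENNReal.ofReal (f τ z.1 z.2) ≤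
      ENNReal.ofReal (δ ^ 7) := fun τ hτ =>
    (hf.isTransported.lintegral_mass_le hC hτ).trans
      ((lintegral_ofReal_le_normL1Linf hu0).trans hnorm)
  -- `K` supplies only the crude increment bounds of the continuity argument; the final estimate
  -- does not see it.
  obtain ⟨K, hK0, hK⟩ := hf.exists_moment_bound hT.le (ne_top_of_le_ne_top ENNReal.ofReal_ne_top h0)
  set I := (interactionConst κ lam).toReal
  have hI0 : 0 ≤ I := ENNReal.toReal_nonneg
  -- Chosen so that `8 e^4 D = 1/4`: on short times `8 e^4` is the cost of passing from the early
  -- weight to `|x - t v|^4`.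
  set D : ℝ := 1 / (32 * Real.exp 4) with hD
  have hD0 : 0 < D := by positivity
  have heD : Real.exp 4 * D = 1 / 32 := by
    rw [hD]
    field_simp
  set T₁ := min 1 T with hT₁
  have hT₁0 : 0 < T₁ := lt_min one_pos hT
  have hT₁1 : T₁ ≤ 1 := min_le_left _ _
  have hT₁T : T₁ ≤ T := min_le_right _ _
  set m : ℝ → ℝ≥0∞ := fun τ => ∫⁻ z : E3 × E3,
    ENNReal.ofReal (earlyWeight (τ, z) * f τ z.1 z.2) with hm
  have hm0 : m 0 ≤ ENNReal.ofReal (δ ^ 7) := by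
    refine le_trans ?_ h0
    have e0 : ∀ z : E3 × E3, earlyWeight (0, z) = ‖z.1‖ ^ 4 + ‖z.2‖ ^ 4 := fun z => by
      simp [earlyWeight]
    simp only [hm, e0]
    rw [lintegral_norm_pow_four_add hu hu0, add_assoc]
    exact le_add_self
  have hearly : ∀ τ ∈ Icc 0 T₁, m τ ≤ ENNReal.ofReal D := by
    refine le_of_increment_le (g := fun r => r)
      (c := 4 * (I * δ ^ 5 * (Real.exp 4 * D) ^ (9 / 7 : ℝ)))
      (k := 4 * (I * δ ^ 5 * (Real.exp 4 * K) ^ (9 / 7 : ℝ)))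
      continuousOn_id monotoneOn_id (by positivity) ?_ ?_ ?_
    · intro s hs r hr hsr h
      exact hf.early_increment hκ hδ hA hD0.le hs.1 hsr (hr.2.trans hT₁1) (hr.2.trans hT₁T) h
    · intro s hs r hr hsr
      exact hf.early_increment hκ hδ hA hK0 hs.1 hsr (hr.2.trans hT₁1) (hr.2.trans hT₁T)
        fun τ hτ => (hK τ ⟨hs.1.trans hτ.1.le, hτ.2.le.trans (hr.2.trans hT₁T)⟩).1
    · refine lt_of_le_of_lt (add_le_add_left hm0 _) ?_
      rw [heD, ← ENNReal.ofReal_add hδ7.le (by positivity), ENNReal.ofReal_lt_ofReal_iff hD0]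
      refine lt_of_le_of_lt ?_ hδ1
      rw [sub_zero]
      exact add_le_add le_rfl (mul_le_of_le_one_right (by positivity) hT₁1)
  have hshort : ∀ τ ∈ Icc 0 T₁, eulerianMoment 4 τ (f τ) ≤ ENNReal.ofReal (1 / 4) := by
    intro τ hτ
    have hτT : τ ∈ Icc 0 T := ⟨hτ.1, hτ.2.trans hT₁T⟩
    have h1 : eulerianMoment 4 τ (f τ) ≤ ENNReal.ofReal (8 * Real.exp 4) * m τ := by
      refine lintegral_ofReal_mul_le (by positivity) (fun z => hf.nonneg τ hτT z.1 z.2) fun z => ?_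
      refine (norm_sub_smul_pow_four_le z.1 z.2 τ).trans ?_
      have hτ4 : τ ^ 4 ≤ 1 := pow_le_one₀ hτ.1 (hτ.2.trans hT₁1)
      have h2 : 0 ≤ ‖z.1‖ ^ 4 := by positivity
      have h3 : 0 ≤ ‖z.2‖ ^ 4 := by positivity
      have h4 : 1 ≤ Real.exp 4 * Real.exp (-4 * τ) := by
        rw [← Real.exp_add]
        exact Real.one_le_exp (by linarith [hτ.2.trans hT₁1])
      calc 8 * (‖z.1‖ ^ 4 + τ ^ 4 * ‖z.2‖ ^ 4) ≤ 8 * (‖z.1‖ ^ 4 + 1 * ‖z.2‖ ^ 4) := by gcongr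
        _ ≤ (Real.exp 4 * Real.exp (-4 * τ)) * (8 * (‖z.1‖ ^ 4 + 1 * ‖z.2‖ ^ 4)) :=
            le_mul_of_one_le_left (by positivity) h4
        _ = _ := by
            simp only [earlyWeight]
            ring
    refine h1.trans ?_
    calc _ ≤ ENNReal.ofReal (8 * Real.exp 4) * ENNReal.ofReal D := by
          gcongr
          exact hearly τ hτ
      _ = ENNReal.ofReal (1 / 4) := by
          rw [← ENNReal.ofReal_mul (by positivity), mul_assoc, heD]
          norm_num
  have h14 : ENNReal.ofReal (1 / 4) ≤ 1 := by
    rw [← ENNReal.ofReal_one]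
    exact ENNReal.ofReal_le_ofReal (by norm_num)
  rcases le_total t 1 with ht1 | ht1
  · exact (hshort t ⟨ht.1, le_min ht1 ht.2⟩).trans h14
  · have h1T : 1 ≤ T := ht1.trans ht.2
    have hT₁eq : T₁ = 1 := min_eq_left h1T
    have hq : 0 < 3 / c - 1 - 1 := by
      obtain ⟨hc1, hc2⟩ := hc
      have : 2 < 3 / c := by rw [lt_div_iff₀ (by linarith)]; linarith
      linarith
    set η := (3 / c - 1 - 1) / (16 * B₀) with hη
    have hη0 : 0 < η := by positivity
    rw [← ENNReal.ofReal_one]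
    -- The second bootstrap starts at time `1` from the value `1/4` and has threshold `1`. The
    -- function `g` is an antiderivative of `r^(-q)`, and its total increment is at most `1 / (q -
    -- 1)` uniformly in `T`.
    refine le_of_increment_le (s₀ := 1) (t₀ := T) (m := fun τ => eulerianMoment 4 τ (f τ))
      (g := fun r => -(r ^ (1 - (3 / c - 1)) / ((3 / c - 1) - 1)))
      (c := 4 * (I * δ ^ 5 * (1 : ℝ) ^ (9 / 7 : ℝ)) + 4 * B₀ * (η * 1 + η⁻¹ ^ 3 * δ ^ 7))
      (k := 4 * (I * δ ^ 5 * K ^ (9 / 7 : ℝ)) + 4 * B₀ * (η * K + η⁻¹ ^ 3 * δ ^ 7))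
      ?_ ?_ (by positivity) ?_ ?_ ?_ t ⟨ht1, ht.2⟩
    · refine ContinuousOn.neg (ContinuousOn.div_const ?_ _)
      exact continuousOn_id.rpow_const fun r hr => Or.inl (by
        have : (1 : ℝ) ≤ r := hr.1
        exact (zero_lt_one.trans_le this).ne')
    · intro r hr s hs hrs
      have hr0 : 0 < r := zero_lt_one.trans_le hr.1
      have := Real.rpow_le_rpow_of_nonpos hr0 hrs (by linarith : 1 - (3 / c - 1) ≤ 0)
      exact neg_le_neg (div_le_div_of_nonneg_right this hq.le)
    · intro s hs r hr hsr h
      exact hf.late_increment hκ hc hB₀ hB hδ hA zero_le_one hδ7.le hη0 hN hs.1 hsr hr.2 h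
    · intro s hs r hr hsr
      exact hf.late_increment hκ hc hB₀ hB hδ hA hK0 hδ7.le hη0 hN hs.1 hsr hr.2
        fun τ hτ => (hK τ ⟨by linarith [hs.1, hτ.1], hτ.2.le.trans hr.2⟩).2
    · refine lt_of_le_of_lt (add_le_add_left (hshort 1 ⟨zero_le_one, hT₁eq.ge⟩) _) ?_
      rw [← ENNReal.ofReal_add (by norm_num) ?_, ENNReal.ofReal_lt_ofReal_iff one_pos]
      · refine lt_of_le_of_lt ?_ hδ2
        gcongr
        rw [Real.one_rpow]
        have : 0 ≤ T ^ (1 - (3 / c - 1)) / (3 / c - 1 - 1) := by positivity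
        linarith
      · refine mul_nonneg (by positivity) ?_
        rw [← neg_sub', neg_nonneg, ← sub_div]
        refine div_nonpos_of_nonpos_of_nonneg ?_ hq.le
        have : T ^ (1 - (3 / c - 1)) ≤ 1 ^ (1 - (3 / c - 1)) :=
          Real.rpow_le_rpow_of_nonpos one_pos h1T (by linarith)
        linarith

end Global

end ScreenedVlasov
end

/-! ### The main theorem -/

theorem mainTheorem4 (κ : ℝ) (hκ : 0 < κ) (lam : ℝ)
    (c : ℝ) (hc : c ∈ Set.Ioo (7 / 5 : ℝ) (3 / 2)) (B₀ : ℝ) (hB₀ : 0 < B₀) :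
    ∃ ε₀ : ℝ, 0 < ε₀ ∧ ∃ Φ : ℝ → ℝ → ℝ → ℝ → ℝ,
      (∀ A M N : ℝ, Continuous (Φ A M N)) ∧
      ∀ (T : ℝ), 0 < T →
      ∀ (B : ℝ → ScreenedVlasov.E3 → ScreenedVlasov.E3),
        ScreenedVlasov.MagneticDecay c B₀ T B →
      ∀ (fin : ScreenedVlasov.E3 → ScreenedVlasov.E3 → ℝ),
        (∀ x v, 0 ≤ fin x v) → ScreenedVlasov.MemL1Linf fin →
      ∀ (Min Nin : ℕ → ℝ),
        (∀ k ≤ 4, 0 < Min k ∧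
          ScreenedVlasov.velocityMoment k fin ≤ ENNReal.ofReal (Min k)) →
        (∀ k ≤ 4, 0 < Nin k ∧
          ScreenedVlasov.positionMoment k fin ≤ ENNReal.ofReal (Nin k)) →
        ScreenedVlasov.normL1Linf fin + ScreenedVlasov.velocityMoment 4 fin
          + ScreenedVlasov.positionMoment 4 fin ≤ ENNReal.ofReal ε₀ →
      ∀ (f : ℝ → ScreenedVlasov.E3 → ScreenedVlasov.E3 → ℝ),
        ScreenedVlasov.IsClassicalSolution κ lam T B fin f →
      ∀ t ∈ Set.Icc 0 T,
        ScreenedVlasov.eulerianMoment 4 t (f t) ≤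
          ENNReal.ofReal
            (Φ (ScreenedVlasov.normL1Linf fin).toReal (Min 4) (Nin 4) t) := by
  have hq : 1 < 3 / c - 1 := by
    obtain ⟨hc1, hc2⟩ := hc
    have : 2 < 3 / c := by rw [lt_div_iff₀ (by linarith)]; linarith
    linarith
  obtain ⟨δ, hδ, hδ1, hδ2⟩ := ScreenedVlasov.exists_small_parameter
    (ScreenedVlasov.interactionConst κ lam).toReal B₀ (3 / c - 1) hB₀ hq
  -- The seventh power matches the normalisation `f ≤ a^7` of the interaction estimate with `a = δ`.
  refine ⟨δ ^ 7, by positivity, fun _ _ _ _ => 1, fun _ _ _ => continuous_const, ?_⟩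
  intro T hT B hB fin _ _ Min Nin _ _ hsmall f hf t ht
  obtain rfl : f 0 = fin := funext fun x => funext fun v => hf.initial x v
  rw [ENNReal.ofReal_one]
  exact hf.eulerianMoment_le_one hκ hT hc hB₀ hB hδ hδ1 hδ2 hsmall ht
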